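/- Let $I=(0,\infty)$, $dm=2x^2\,dx$ on $I$, and let $\mathcal E$ be the Bessel Dirichlet form for $n=3$ on $L^2(I,m)$: $$\mathcal D=\Big\{u\in L^2(I,m):\ u \text{ locally absolutely continuous on } I,\ \int_0^\infty u'(x)^2x^2\,dx<\infty\Big\},\qquad \mathcal E[u]=\int_0^\infty u'(x)^2x^2\,dx .$$ For $\lambda>0$ put $\mathcal E_\lambda[u]=\mathcal E[u]+\lambda\|u\|_{L^2(I,m)}^2$. Let $\mathbb N=\{1,2,\dots\}$, let $a_k>0$ for every $k\in\mathbb N$, let $\mu=\sum_{k\in\mathbb N}a_k\delta_k$ and $\ell^2(\mu)=L^2(\mathbb N,\mu)$. Let $J$ be the restriction operator from $\mathcal D$ to $\ell^2(\mu)$, $$D(J)=\Big\{u\in\mathcal D:\ \sum_{k\in\mathbb N}a_ku(k)^2<\infty\Big\},\qquad Ju=u|_{\mathbb N},$$ let $P_\lambda$ be the orthogonal projection in $(\mathcal D,\mathcal E_\lambda)$ onto the orthogonal complement of $\ker J$, and let $\check{\mathcal E}_\lambda$ be the quadratic form in $\ell^2(\mu)$ with domain $\operatorname{ran}J$ given by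 $\check{\mathcal E}_\lambda[Ju]=\mathcal E_\lambda[P_\lambda u]$ for $u\in D(J)$. The trace form $\check{\mathcal E}$ of $\mathcal E$ with respect to $\mu$ is the Mosco limit of $\check{\mathcal E}_\lambda$ in $\ell^2(\mu)$ as $\lambda\downarrow0$. For $u=(u_k)\in\ell^2(\mu)$ set $$Q[u]=\sum_{k=1}^\infty k(k+1)(u_{k+1}-u_k)^2\in[0,\infty].$$ Then the trace form $\check{\mathcal E}$ exists (as a unique Mosco limit), and: 1. The restriction $Q|_{\operatorname{ran}J}$ of $Q$ to $\operatorname{ran}J$ is closable in $\ell^2(\mu)$, and $\check{\mathcal E}$ is its closure. 2. If $\mu(\mathbb N)=\infty$, then $D(\check{\mathcal E})=\{u\in\ell^2(\mu): Q[u]<\infty\}$, and $\check{\mathcal E}[u]=Q[u]$ for every $u\in D(\check{\mathcal E})$. -/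

import Mathlib

open Set Filter Topology MeasureTheory
open scoped ENNReal

noncomputable section

/-! ### Quadratic forms on a real Hilbert space

A (nonnegative) quadratic form with domain `D ⊆ H` is represented by the functional `q : H → [0,∞]`
which is the form on `D` and is `∞` off `D`. -/

namespace QForm

variable {H : Type*} [NormedAddCommGroup H]

/-- The domain of a quadratic form. -/
def dom (q : H → ℝ≥0∞) : Set H := {u | q u < ⊤}

open Classical in
/-- The restriction of a form to a set `S`, i.e. the form with domain `dom q ∩ S`. -/
def restrict (q : H → ℝ≥0∞) (S : Set H) : H → ℝ≥0∞ := fun u => if u ∈ S then q u else ⊤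

/-- `s` is a sequence in the domain of `q` which is `q`-Cauchy and converges to `u` in `H`. -/
def Approx (q : H → ℝ≥0∞) (s : ℕ → H) (u : H) : Prop :=
  (∀ i, s i ∈ dom q) ∧ Tendsto s atTop (𝓝 u) ∧
    ∀ ε : ℝ≥0∞, 0 < ε → ∃ N : ℕ, ∀ i ≥ N, ∀ j ≥ N, q (s i - s j) < ε

/-- `q` is closable. -/
def IsClosable (q : H → ℝ≥0∞) : Prop :=
  ∀ s : ℕ → H, Approx q s 0 → Tendsto (fun i => q (s i)) atTop (𝓝 0)

/-- `E` is the closure of `q`: its domain consists of the limits of the `q`-Cauchy convergent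
sequences, and its value at such a limit is the limit of the values of `q`. -/
def IsClosureOf (E q : H → ℝ≥0∞) : Prop :=
  IsClosable q ∧ (∀ u, u ∈ dom E ↔ ∃ s, Approx q s u) ∧
    ∀ u s, Approx q s u → Tendsto (fun i => q (s i)) atTop (𝓝 (E u))

/-- `E` is the Mosco limit of the forms `q lam` as `lam ↓ 0`. The first condition is the lower bound
along weakly convergent sequences, the second the existence of strongly convergent recovery
sequences. -/
def IsMoscoLimit [InnerProductSpace ℝ H] (q : ℝ → H → ℝ≥0∞) (E : H → ℝ≥0∞) : Prop :=
  ∀ lam : ℕ → ℝ, (∀ i, 0 < lam i) → Tendsto lam atTop (𝓝 0) →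
    (∀ (s : ℕ → H) (u : H),
      (∀ v : H, Tendsto (fun i => inner ℝ v (s i)) atTop (𝓝 (inner ℝ v u))) →
        E u ≤ liminf (fun i => q (lam i) (s i)) atTop) ∧
    (∀ u : H, ∃ s : ℕ → H, Tendsto s atTop (𝓝 u) ∧
        limsup (fun i => q (lam i) (s i)) atTop ≤ E u)

end QForm

/-! ### The Bessel form on `I = (0,∞)`

Functions on `I` are written as functions on `ℝ`; only their values on `I` play a role. -/

namespace Bessel

/-- The measure `dm = 2 x^(n-1) dx` on `(0,∞)`. -/
def m (n : ℕ) : Measure ℝ :=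
  (volume.restrict (Ioi 0)).withDensity fun x => ENNReal.ofReal (2 * x ^ (n - 1))

/-- `AC(I)`: absolute continuity on the compact subintervals of `(0,∞)`. -/
def LocAC (u : ℝ → ℝ) : Prop :=
  ∀ x y : ℝ, 0 < x → x < y → AbsolutelyContinuousOnInterval u x y

/-- The domain of the Bessel form. -/
def domain (n : ℕ) : Set (ℝ → ℝ) :=
  {u | LocAC u ∧ IntegrableOn (fun x => deriv u x ^ 2 * x ^ (n - 1)) (Ioi 0) ∧
    MemLp u 2 (m n)}

/-- The Bessel form `𝓔(u,v) = ∫₀^∞ u' v' x^(n-1) dx`. -/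
def form (n : ℕ) (u v : ℝ → ℝ) : ℝ :=
  ∫ x in Ioi (0 : ℝ), deriv u x * deriv v x * x ^ (n - 1)

/-- `𝓔_lam(u,v) = 𝓔(u,v) + lam (u,v)_{L²(I,m)}`. -/
def formAt (n : ℕ) (lam : ℝ) (u v : ℝ → ℝ) : ℝ :=
  form n u v + lam * ∫ x, u x * v x ∂(m n)

/-! ### The trace with respect to `μ = ∑ a_k δ_k` on `{1, 2, …}` -/

/-- Every set of positive integers is measurable. -/
instance instMeasurableSpacePNat : MeasurableSpace ℕ+ := ⊤

/-- The measure `μ = ∑ a_k δ_k` on the positive integers. -/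
def atomic (a : ℕ+ → ℝ) : Measure ℕ+ :=
  Measure.sum fun k => ENNReal.ofReal (a k) • Measure.dirac k

/-- The Hilbert space `ℓ²(μ) = L²({1, 2, …}, μ)`. -/
abbrev ell2 (a : ℕ+ → ℝ) := Lp ℝ 2 (atomic a)

/-- The domain of the restriction operator `J`. -/
def domJ (n : ℕ) (a : ℕ+ → ℝ) : Set (ℝ → ℝ) :=
  {u | u ∈ domain n ∧ Summable fun k : ℕ+ => a k * u (k : ℝ) ^ 2}

/-- The graph of `J`: `u ∈ D(J)` and `f = J u`, i.e. `f` is the restriction of `u` to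
`{1, 2, …}`. -/
def GraphJ (n : ℕ) (a : ℕ+ → ℝ) (u : ℝ → ℝ) (f : ell2 a) : Prop :=
  u ∈ domJ n a ∧ ∀ k : ℕ+, f k = u (k : ℝ)

/-- The range of `J`. -/
def ranJ (n : ℕ) (a : ℕ+ → ℝ) : Set (ell2 a) := {f | ∃ u, GraphJ n a u f}

/-- The kernel of `J`. -/
def kerJ (n : ℕ) : Set (ℝ → ℝ) := {u | u ∈ domain n ∧ ∀ k : ℕ+, u (k : ℝ) = 0}

/-- The orthogonal complement of `ker J` in `(𝓓, 𝓔_lam)`. -/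
def kerJOrth (n : ℕ) (lam : ℝ) : Set (ℝ → ℝ) :=
  {w | w ∈ domain n ∧ ∀ v ∈ kerJ n, formAt n lam w v = 0}

/-- `w = P_lam u`: the function `w` is the orthogonal projection of `u`, in `(𝓓, 𝓔_lam)`, onto the
orthogonal complement of `ker J`. -/
def IsProj (n : ℕ) (lam : ℝ) (u w : ℝ → ℝ) : Prop :=
  w ∈ kerJOrth n lam ∧ ∀ z ∈ kerJOrth n lam, formAt n lam (fun x => u x - w x) z = 0

/-- The form with domain `ran J` given by `J u ↦ 𝓔_lam[P_lam u]`. The infimum runs over a set with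
at most one element, as `P_lam u` depends only on `J u`; it is `∞` (empty infimum) off `ran J`. -/
def traceAt (n : ℕ) (a : ℕ+ → ℝ) (lam : ℝ) (f : ell2 a) : ℝ≥0∞ :=
  sInf {e | ∃ u w, GraphJ n a u f ∧ IsProj n lam u w ∧ e = ENNReal.ofReal (formAt n lam w w)}

/-- `E` is the trace of the Bessel form with respect to `μ`, i.e. the Mosco limit of the forms
`traceAt n a lam` as `lam ↓ 0`. -/
def IsTraceForm (n : ℕ) (a : ℕ+ → ℝ) (E : ell2 a → ℝ≥0∞) : Prop :=
  QForm.IsMoscoLimit (traceAt n a) E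

/-- `Q[u] = ∑ k (k+1) (u_{k+1} - u_k)²`, with values in `[0,∞]`. -/
def Q (a : ℕ+ → ℝ) (u : ell2 a) : ℝ≥0∞ :=
  ∑' k : ℕ+, ENNReal.ofReal ((k : ℝ) * ((k : ℝ) + 1) * (u (k + 1) - u k) ^ 2)

end Bessel

end

/-! On `[k, k+1]` the scale function of the form is `-1/x`, and `∫ x⁻² dx` over that interval equals
`1/(k(k+1))`. By Cauchy–Schwarz the energy of `u` there is at least `k(k+1)(u(k+1) - u(k))²`, with
equality when the flux `x²u'` is constant. Summing gives `Q ≤ 𝓔`, hence `Q` lies below every trace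
form at level `lam > 0` (`energy_le_form`, `Q_le_traceAt`). Conversely, a finitely supported
sequence has a harmonic extension with compactly supported flux; it lies in `L²`, so its trace form
at level `lam` is at most `Q + lam * C` with `C` independent of `lam` (`exists_traceAt_le`).

The limit is `limitForm`: `Q` on the sequences that vanish at infinity. The constraint appears
because an element of the domain is in `L²` and must tend to `0` along the integers
(`tendsto_zero_of_mem_domain`). It survives limits because finite energy together with vanishing at
infinity gives the decay `v k ^ 2 ≤ energy v / (k + 1)`, uniform on sublevel sets (`sq_le_energy`,
`isClosed_limitForm_le`). Closed convex sublevel sets give weak lower semicontinuity, the lower half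
of Mosco convergence.

The upper half and the closure statement use the same approximants, `f - clamp ε f` with `ε ↓ 0`:
they are finitely supported when `f` vanishes at infinity, do not increase `Q`, and converge to `f`
both in norm and in `Q`. If the total mass is infinite, a sequence in `ℓ²(μ)` with `Q` finite has a
limit at infinity, which can only be `0`, so the constraint is automatic. -/

noncomputable section

namespace Bessel

/-! ### Energies of real sequences. -/

/-- The energy `∑ (k+1)(k+2)(v (k+1) - v k)²` of a real sequence indexed from zero. -/
def energy (v : ℕ → ℝ) : ℝ≥0∞ :=
  ∑' k : ℕ, ENNReal.ofReal (((k : ℝ) + 1) * ((k : ℝ) + 2) * (v (k + 1) - v k) ^ 2)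

lemma energy_mono {v w : ℕ → ℝ} (h : ∀ k, |v (k + 1) - v k| ≤ |w (k + 1) - w k|) :
    energy v ≤ energy w := by
  refine ENNReal.tsum_le_tsum fun k => ENNReal.ofReal_le_ofReal ?_
  have := sq_le_sq.2 (h k)
  gcongr

lemma energy_neg (v : ℕ → ℝ) : energy (fun k => -v k) = energy v := by
  refine tsum_congr fun k => ?_
  congr 2
  ring

/-- Young's inequality termwise. The free parameter lets the factor of `energy v` tend to `1`, which
yields continuity of the energy along convergent sequences. -/
lemma energy_add_le {t : ℝ} (ht : 0 < t) (v w : ℕ → ℝ) :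
    energy (fun k => v k + w k) ≤
      ENNReal.ofReal (1 + t) * energy v + ENNReal.ofReal (1 + t⁻¹) * energy w := by
  unfold energy
  rw [← ENNReal.tsum_mul_left, ← ENNReal.tsum_mul_left, ← ENNReal.tsum_add]
  refine ENNReal.tsum_le_tsum fun k => ?_
  rw [← ENNReal.ofReal_mul (by positivity), ← ENNReal.ofReal_mul (by positivity),
    ← ENNReal.ofReal_add (by positivity) (by positivity)]
  refine ENNReal.ofReal_le_ofReal ?_
  set x := v (k + 1) - v k
  set y := w (k + 1) - w k
  have h : (x + y) ^ 2 ≤ (1 + t) * x ^ 2 + (1 + t⁻¹) * y ^ 2 := by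
    have h1 : (1 + t) * x ^ 2 + (1 + t⁻¹) * y ^ 2 - (x + y) ^ 2 = t * (x - t⁻¹ * y) ^ 2 := by
      field_simp
      ring
    have h2 : 0 ≤ t * (x - t⁻¹ * y) ^ 2 := by positivity
    linarith
  calc _ = ((k : ℝ) + 1) * ((k : ℝ) + 2) * (x + y) ^ 2 := by simp only [x, y]; ring
    _ ≤ ((k : ℝ) + 1) * ((k : ℝ) + 2) * ((1 + t) * x ^ 2 + (1 + t⁻¹) * y ^ 2) := by gcongr
    _ = _ := by ring

lemma energy_sub_le (v w : ℕ → ℝ) :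
    energy (fun k => v k - w k) ≤ 2 * energy v + 2 * energy w := by
  have h := energy_add_le one_pos v (fun k => -w k)
  rw [energy_neg] at h
  norm_num at h
  simpa [sub_eq_add_neg] using h

lemma energy_convex {s t : ℝ} (hs : 0 ≤ s) (ht : 0 ≤ t) (hst : s + t = 1) (v w : ℕ → ℝ) :
    energy (fun k => s * v k + t * w k) ≤
      ENNReal.ofReal s * energy v + ENNReal.ofReal t * energy w := by
  unfold energy
  rw [← ENNReal.tsum_mul_left, ← ENNReal.tsum_mul_left, ← ENNReal.tsum_add]
  refine ENNReal.tsum_le_tsum fun k => ?_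
  rw [← ENNReal.ofReal_mul (by positivity), ← ENNReal.ofReal_mul (by positivity),
    ← ENNReal.ofReal_add (by positivity) (by positivity)]
  refine ENNReal.ofReal_le_ofReal ?_
  set x := v (k + 1) - v k
  set y := w (k + 1) - w k
  have h : (s * x + t * y) ^ 2 ≤ s * x ^ 2 + t * y ^ 2 := by
    obtain rfl : s = 1 - t := by linarith
    have : 0 ≤ (1 - t) * t * (x - y) ^ 2 := by positivity
    nlinarith
  calc _ = ((k : ℝ) + 1) * ((k : ℝ) + 2) * (s * x + t * y) ^ 2 := by simp only [x, y]; ring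
    _ ≤ ((k : ℝ) + 1) * ((k : ℝ) + 2) * (s * x ^ 2 + t * y ^ 2) := by gcongr
    _ = _ := by ring

lemma tendsto_energy_term {l : Filter ℕ} {v : ℕ → ℕ → ℝ} {w : ℕ → ℝ}
    (h : ∀ k, Tendsto (fun i => v i k) l (𝓝 (w k))) (k : ℕ) :
    Tendsto (fun i => ENNReal.ofReal
        (((k : ℝ) + 1) * ((k : ℝ) + 2) * (v i (k + 1) - v i k) ^ 2)) l
      (𝓝 (ENNReal.ofReal (((k : ℝ) + 1) * ((k : ℝ) + 2) * (w (k + 1) - w k) ^ 2))) :=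
  ENNReal.tendsto_ofReal ((((h (k + 1)).sub (h k)).pow 2).const_mul _)

/-- Fatou's lemma for the counting measure. -/
lemma energy_le_liminf {v : ℕ → ℕ → ℝ} {w : ℕ → ℝ}
    (h : ∀ k, Tendsto (fun i => v i k) atTop (𝓝 (w k))) :
    energy w ≤ liminf (fun i => energy (v i)) atTop := by
  have := lintegral_liminf_le (μ := Measure.count) (u := atTop)
    (f := fun (i k : ℕ) => ENNReal.ofReal
      (((k : ℝ) + 1) * ((k : ℝ) + 2) * (v i (k + 1) - v i k) ^ 2)) fun _ => measurable_from_top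
  simp only [lintegral_count, (tendsto_energy_term h _).liminf_eq] at this
  exact this

lemma tendsto_energy_zero {v : ℕ → ℕ → ℝ} {w : ℕ → ℝ} (hw : energy w < ⊤)
    (hvw : ∀ i k, |v i (k + 1) - v i k| ≤ |w (k + 1) - w k|)
    (h : ∀ k, Tendsto (fun i => v i k) atTop (𝓝 0)) :
    Tendsto (fun i => energy (v i)) atTop (𝓝 0) := by
  have := tendsto_lintegral_of_dominated_convergence (μ := Measure.count)
    (F := fun (i k : ℕ) => ENNReal.ofReal
      (((k : ℝ) + 1) * ((k : ℝ) + 2) * (v i (k + 1) - v i k) ^ 2)) (f := fun _ => 0)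
    (fun k => ENNReal.ofReal (((k : ℝ) + 1) * ((k : ℝ) + 2) * (w (k + 1) - w k) ^ 2))
    (fun _ => measurable_from_top)
    (fun i => ae_of_all _ fun k => ENNReal.ofReal_le_ofReal (by
      have := sq_le_sq.2 (hvw i k)
      gcongr))
    (by rw [lintegral_count]; exact hw.ne)
    (ae_of_all _ fun k => by simpa using tendsto_energy_term (w := fun _ => 0) h k)
  simp only [lintegral_count, tsum_zero] at this
  exact this

lemma sum_le_energy {v : ℕ → ℝ} (hv : energy v < ⊤) (s : Finset ℕ) :
    ∑ k ∈ s, ((k : ℝ) + 1) * ((k : ℝ) + 2) * (v (k + 1) - v k) ^ 2 ≤ (energy v).toReal := by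
  have h := ENNReal.toReal_mono hv.ne (ENNReal.sum_le_tsum (f := fun k : ℕ =>
    ENNReal.ofReal (((k : ℝ) + 1) * ((k : ℝ) + 2) * (v (k + 1) - v k) ^ 2)) s)
  rwa [← ENNReal.ofReal_sum_of_nonneg fun k _ => by positivity,
    ENNReal.toReal_ofReal (Finset.sum_nonneg fun k _ => by positivity)] at h

/-- Cauchy–Schwarz with the reciprocal weights `1/((i+1)(i+2))`, whose sum over `i ≥ k` telescopes
to `1/(k+1)`. This summability is what gives finite-energy sequences a limit at infinity. -/
lemma sq_sub_le_energy {v : ℕ → ℝ} (hv : energy v < ⊤) {j k : ℕ} (hkj : k ≤ j) :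
    (v j - v k) ^ 2 ≤ (energy v).toReal / (k + 1) := by
  rcases hkj.eq_or_lt with rfl | hlt
  · simp only [sub_self, ne_eq, OfNat.ofNat_ne_zero, not_false_eq_true, zero_pow]
    positivity
  have h1 := Finset.sq_sum_div_le_sum_sq_div (Finset.Ico k j) (fun i => v (i + 1) - v i)
    (g := fun i => 1 / (((i : ℝ) + 1) * ((i : ℝ) + 2))) (fun i _ => by positivity)
  rw [Finset.sum_Ico_sub v hkj] at h1
  have h2 : ∑ i ∈ Finset.Ico k j, 1 / (((i : ℝ) + 1) * ((i : ℝ) + 2)) ≤ 1 / ((k : ℝ) + 1) := by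
    have := Finset.sum_Ico_sub (fun i : ℕ => -(1 / ((i : ℝ) + 1))) hkj
    have h3 : 0 ≤ 1 / ((j : ℝ) + 1) := by positivity
    calc _ = ∑ i ∈ Finset.Ico k j, (-(1 / (((i + 1 : ℕ) : ℝ) + 1)) - -(1 / ((i : ℝ) + 1))) := by
          refine Finset.sum_congr rfl fun i _ => ?_
          push_cast
          field_simp
          ring
      _ ≤ _ := by rw [this]; linarith
  have hpos : 0 < ∑ i ∈ Finset.Ico k j, 1 / (((i : ℝ) + 1) * ((i : ℝ) + 2)) :=
    Finset.sum_pos (fun i _ => by positivity) (Finset.nonempty_Ico.2 hlt)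
  rw [div_le_iff₀ hpos] at h1
  refine h1.trans ?_
  rw [div_eq_mul_one_div]
  gcongr
  refine le_trans (le_of_eq ?_) (sum_le_energy hv (Finset.Ico k j))
  refine Finset.sum_congr rfl fun i _ => ?_
  field_simp

lemma sq_le_energy {v : ℕ → ℝ} (hv : energy v < ⊤) (h0 : Tendsto v atTop (𝓝 0)) (k : ℕ) :
    v k ^ 2 ≤ (energy v).toReal / (k + 1) := by
  have h : Tendsto (fun j => (v j - v k) ^ 2) atTop (𝓝 ((0 - v k) ^ 2)) :=
    (h0.sub_const _).pow 2
  have := le_of_tendsto h (eventually_atTop.2 ⟨k, fun j hj => sq_sub_le_energy hv hj⟩)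
  simpa using this

lemma tendsto_energy_div (c : ℝ) :
    Tendsto (fun k : ℕ => c / ((k : ℝ) + 1)) atTop (𝓝 0) :=
  tendsto_const_nhds.div_atTop (tendsto_atTop_add_const_right _ _ tendsto_natCast_atTop_atTop)

lemma tendsto_zero_of_sq_le {v : ℕ → ℝ} {c : ℝ} (h : ∀ k : ℕ, v k ^ 2 ≤ c / (k + 1)) :
    Tendsto v atTop (𝓝 0) := by
  have h2 : Tendsto (fun k => v k ^ 2) atTop (𝓝 0) :=
    squeeze_zero (fun k => sq_nonneg _) h (tendsto_energy_div c)
  have h3 := h2.sqrt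
  simp only [Real.sqrt_sq_eq_abs, Real.sqrt_zero] at h3
  exact (tendsto_zero_iff_abs_tendsto_zero _).2 h3

lemma exists_tendsto_of_energy {v : ℕ → ℝ} (hv : energy v < ⊤) :
    ∃ c, Tendsto v atTop (𝓝 c) := by
  refine cauchySeq_tendsto_of_complete (cauchySeq_of_le_tendsto_0'
    (fun k : ℕ => √((energy v).toReal / ((k : ℝ) + 1))) (fun k j hkj => ?_) ?_)
  · rw [dist_comm, Real.dist_eq]
    exact Real.abs_le_sqrt (sq_sub_le_energy hv hkj)
  · simpa using (tendsto_energy_div (energy v).toReal).sqrt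

/-! ### Truncation of real numbers. -/

/-- Projection of the real line onto `[-ε, ε]`. -/
def clamp (ε t : ℝ) : ℝ := max (-ε) (min ε t)

lemma abs_clamp_sub_le (ε x y : ℝ) : |clamp ε x - clamp ε y| ≤ |x - y| := by
  unfold clamp
  have h1 := abs_max_sub_max_le_max (-ε) (min ε x) (-ε) (min ε y)
  have h2 := abs_min_sub_min_le_max ε x ε y
  simp only [sub_self, abs_zero, abs_nonneg, max_eq_right] at h1 h2
  exact h1.trans h2

/-- Soft thresholding is a contraction, just as `clamp` is; both parts of the splitting therefore
have energy at most that of the original sequence. -/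
lemma abs_residual_sub_le {ε : ℝ} (hε : 0 ≤ ε) (x y : ℝ) :
    |(x - clamp ε x) - (y - clamp ε y)| ≤ |x - y| := by
  unfold clamp
  rcases max_cases (-ε) (min ε x) with h1 | h1 <;> rcases min_cases ε x with h2 | h2 <;>
    rcases max_cases (-ε) (min ε y) with h3 | h3 <;> rcases min_cases ε y with h4 | h4 <;>
    rw [h1.1, h3.1] <;> simp only [h2.1, h4.1] at * <;>
    rw [abs_le] <;> rcases abs_cases (x - y) with h5 | h5 <;> constructor <;> linarith

lemma abs_clamp_le {ε : ℝ} (hε : 0 ≤ ε) (x : ℝ) : |clamp ε x| ≤ ε :=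
  abs_le.2 ⟨le_max_left _ _, max_le (by linarith) (min_le_left _ _)⟩

lemma clamp_zero {ε : ℝ} (hε : 0 ≤ ε) : clamp ε 0 = 0 := by
  simp [clamp, hε]

lemma clamp_eq_self {ε x : ℝ} (h : |x| ≤ ε) : clamp ε x = x := by
  rw [abs_le] at h
  rw [clamp, min_eq_right h.2, max_eq_right h.1]

/-! ### Pointwise calculus and truncation in `ℓ²(μ)`. -/

/-- Every atom is charged, so classes in `ell2 a` have well-defined values and the almost-everywhere
identities of `Lp` hold at each point. -/
lemma ae_atomic {a : ℕ+ → ℝ} (ha : ∀ k, 0 < a k) {p : ℕ+ → Prop} :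
    (∀ᵐ k ∂(atomic a), p k) ↔ ∀ k, p k := by
  rw [atomic, Measure.ae_sum_iff]
  refine forall_congr' fun k => ?_
  rw [Measure.ae_ennreal_smul_measure_iff (by simpa using ha k), ae_dirac_eq]
  rfl

lemma atomic_singleton (a : ℕ+ → ℝ) (k : ℕ+) : atomic a {k} = ENNReal.ofReal (a k) := by
  rw [atomic, Measure.sum_apply _ (MeasurableSet.singleton k), tsum_eq_single k]
  · simp
  · intro j hj
    simp [hj]

section pointwise

variable {a : ℕ+ → ℝ}

lemma ell2_add_apply (ha : ∀ k, 0 < a k) (f g : ell2 a) (k : ℕ+) : (f + g) k = f k + g k :=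
  (ae_atomic ha).1 (Lp.coeFn_add f g) k

lemma ell2_sub_apply (ha : ∀ k, 0 < a k) (f g : ell2 a) (k : ℕ+) : (f - g) k = f k - g k :=
  (ae_atomic ha).1 (Lp.coeFn_sub f g) k

lemma ell2_smul_apply (ha : ∀ k, 0 < a k) (c : ℝ) (f : ell2 a) (k : ℕ+) :
    (c • f) k = c * f k :=
  (ae_atomic ha).1 (Lp.coeFn_smul c f) k

lemma ell2_zero_apply (ha : ∀ k, 0 < a k) (k : ℕ+) : (0 : ell2 a) k = 0 :=
  (ae_atomic ha).1 (Lp.coeFn_zero ℝ 2 (atomic a)) k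

lemma toLp_apply (ha : ∀ k, 0 < a k) {g : ℕ+ → ℝ} (hg : MemLp g 2 (atomic a)) (k : ℕ+) :
    hg.toLp g k = g k :=
  (ae_atomic ha).1 hg.coeFn_toLp k

lemma ell2_norm_sq (f : ell2 a) : ‖f‖ ^ 2 = ∫ k, f k ^ 2 ∂(atomic a) := by
  rw [← real_inner_self_eq_norm_sq, L2.inner_def]
  refine integral_congr_ae (ae_of_all _ fun k => ?_)
  simp [pow_two]

lemma integrable_sq (f : ell2 a) : Integrable (fun k => f k ^ 2) (atomic a) :=
  (Lp.memLp f).integrable_sq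

lemma mul_sq_le_norm_sq (ha : ∀ k, 0 < a k) (f : ell2 a) (k : ℕ+) :
    a k * f k ^ 2 ≤ ‖f‖ ^ 2 := by
  have h := setIntegral_le_integral (s := {k}) (integrable_sq f)
    (ae_of_all _ fun j => sq_nonneg (f j))
  rw [integral_singleton, ← ell2_norm_sq, measureReal_def, atomic_singleton,
    ENNReal.toReal_ofReal (ha k).le, smul_eq_mul] at h
  exact h

lemma tendsto_apply (ha : ∀ k, 0 < a k) {ι : Type*} {l : Filter ι} {s : ι → ell2 a} {f : ell2 a}
    (h : Tendsto s l (𝓝 f)) (k : ℕ+) : Tendsto (fun i => s i k) l (𝓝 (f k)) := by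
  rw [tendsto_iff_norm_sub_tendsto_zero] at h ⊢
  have h2 : Tendsto (fun i => √(‖s i - f‖ ^ 2 / a k)) l (𝓝 0) := by
    simpa using ((h.pow 2).div_const (a k)).sqrt
  refine squeeze_zero (fun i => norm_nonneg _) (fun i => ?_) h2
  rw [Real.norm_eq_abs]
  refine Real.abs_le_sqrt ?_
  rw [le_div_iff₀ (ha k), ← ell2_sub_apply ha, mul_comm]
  exact mul_sq_le_norm_sq ha _ k

/-- The values of `f` as a sequence indexed from zero. -/
def seq (f : ell2 a) (k : ℕ) : ℝ := f k.succPNat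

lemma Q_eq_energy (f : ell2 a) : Q a f = energy (seq f) := by
  unfold Q energy seq
  rw [← Equiv.pnatEquivNat.symm.tsum_eq]
  refine tsum_congr fun k => ?_
  have h : (k.succPNat + 1 : ℕ+) = (k + 1).succPNat := rfl
  simp only [Equiv.pnatEquivNat_symm_apply, h, Nat.succPNat_coe, Nat.cast_succ]
  congr 2
  ring

lemma seq_add (ha : ∀ k, 0 < a k) (f g : ell2 a) : seq (f + g) = fun k => seq f k + seq g k :=
  funext fun _ => ell2_add_apply ha f g _

lemma seq_sub (ha : ∀ k, 0 < a k) (f g : ell2 a) : seq (f - g) = fun k => seq f k - seq g k :=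
  funext fun _ => ell2_sub_apply ha f g _

lemma seq_smul (ha : ∀ k, 0 < a k) (c : ℝ) (f : ell2 a) : seq (c • f) = fun k => c * seq f k :=
  funext fun _ => ell2_smul_apply ha c f _

lemma seq_zero (ha : ∀ k, 0 < a k) : seq (0 : ell2 a) = fun _ => 0 :=
  funext fun _ => ell2_zero_apply ha _

lemma Q_zero (ha : ∀ k, 0 < a k) : Q a 0 = 0 := by
  rw [Q_eq_energy, seq_zero ha]
  simp [energy]

/-- Vanishing of the limit at infinity when the total mass is infinite. -/
lemma tendsto_seq_of_infinite (hinf : atomic a univ = ⊤) {f : ell2 a}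
    (hf : Q a f < ⊤) : Tendsto (seq f) atTop (𝓝 0) := by
  rw [Q_eq_energy] at hf
  obtain ⟨c, hc⟩ := exists_tendsto_of_energy hf
  by_cases hc0 : c = 0
  · rwa [hc0] at hc
  exfalso
  have hc2 : 0 < c ^ 2 := by positivity
  have hev : ∀ᶠ k in atTop, c ^ 2 / 2 < seq f k ^ 2 :=
    (hc.pow 2).eventually_const_lt (by linarith)
  obtain ⟨N, hN⟩ := eventually_atTop.1 hev
  -- Integrability of `f²` bounds the mass of this set (Chebyshev), while its complement consists of
  -- finitely many atoms; together they contradict infinite total mass.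
  have hfin : atomic a {k | c ^ 2 / 2 ≤ f k ^ 2} < ⊤ :=
    (integrable_sq f).measure_ge_lt_top (by positivity)
  have hcompl : atomic a {k | c ^ 2 / 2 ≤ f k ^ 2}ᶜ < ⊤ := by
    have hsub : {k | c ^ 2 / 2 ≤ f k ^ 2}ᶜ ⊆ ⋃ n ∈ Finset.range N, {Nat.succPNat n} := by
      intro k hk
      simp only [mem_compl_iff, mem_ofPred_eq, not_le] at hk
      simp only [mem_iUnion, mem_singleton_iff, Finset.mem_range]
      refine ⟨k.natPred, ?_, (PNat.succPNat_natPred k).symm⟩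
      by_contra hlt
      have := hN k.natPred (not_lt.1 hlt)
      rw [seq, PNat.succPNat_natPred] at this
      linarith
    refine (measure_mono hsub).trans_lt ((measure_biUnion_finset_le _ _).trans_lt ?_)
    refine ENNReal.sum_lt_top.2 fun n _ => ?_
    rw [atomic_singleton]
    exact ENNReal.ofReal_lt_top
  have := measure_union_le (μ := atomic a) {k | c ^ 2 / 2 ≤ f k ^ 2} {k | c ^ 2 / 2 ≤ f k ^ 2}ᶜ
  rw [union_compl_self, hinf] at this
  exact absurd (ENNReal.add_lt_top.2 ⟨hfin, hcompl⟩) (not_lt.2 this)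

lemma measurable_pnat {β : Type*} [MeasurableSpace β] (g : ℕ+ → β) : Measurable g :=
  measurable_from_top

lemma memLp_residual (f : ell2 a) {ε : ℝ} (hε : 0 ≤ ε) :
    MemLp (fun k => f k - clamp ε (f k)) 2 (atomic a) := by
  refine (Lp.memLp f).of_le (measurable_pnat _).aestronglyMeasurable (ae_of_all _ fun k => ?_)
  simpa [clamp_zero hε] using abs_residual_sub_le hε (f k) 0

/-- The truncation `f - clamp ε f` of `f`. -/
def residual (f : ell2 a) {ε : ℝ} (hε : 0 ≤ ε) : ell2 a := (memLp_residual f hε).toLp _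

lemma seq_residual (ha : ∀ k, 0 < a k) (f : ell2 a) {ε : ℝ} (hε : 0 ≤ ε) (k : ℕ) :
    seq (residual f hε) k = seq f k - clamp ε (seq f k) :=
  toLp_apply ha (memLp_residual f hε) _

lemma eventually_residual_eq_zero (ha : ∀ k, 0 < a k) {f : ell2 a}
    (hf : Tendsto (seq f) atTop (𝓝 0)) {ε : ℝ} (hε : 0 < ε) :
    ∃ N, ∀ k ≥ N, seq (residual f hε.le) k = 0 := by
  obtain ⟨N, hN⟩ := Metric.tendsto_atTop.1 hf ε hε
  refine ⟨N, fun k hk => ?_⟩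
  have := hN k hk
  rw [Real.dist_eq, sub_zero] at this
  rw [seq_residual ha, clamp_eq_self this.le, sub_self]

lemma Q_residual_le (ha : ∀ k, 0 < a k) (f : ell2 a) {ε : ℝ} (hε : 0 ≤ ε) :
    Q a (residual f hε) ≤ Q a f := by
  rw [Q_eq_energy, Q_eq_energy]
  refine energy_mono fun k => ?_
  rw [seq_residual ha, seq_residual ha]
  exact abs_residual_sub_le hε _ _

variable {ε : ℕ → ℝ}

lemma tendsto_clamp (hε : ∀ i, 0 ≤ ε i) (hε0 : Tendsto ε atTop (𝓝 0)) (x : ℝ) :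
    Tendsto (fun i => clamp (ε i) x) atTop (𝓝 0) :=
  squeeze_zero_norm (fun i => abs_clamp_le (hε i) x) hε0

lemma tendsto_residual (ha : ∀ k, 0 < a k) (f : ell2 a) (hε : ∀ i, 0 ≤ ε i)
    (hε0 : Tendsto ε atTop (𝓝 0)) :
    Tendsto (fun i => residual f (hε i)) atTop (𝓝 f) := by
  rw [tendsto_iff_norm_sub_tendsto_zero]
  have hsub : ∀ i, ∀ k, (residual f (hε i) - f) k ^ 2 = clamp (ε i) (f k) ^ 2 := by
    intro i k
    rw [ell2_sub_apply ha, residual, toLp_apply ha]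
    ring
  have h : Tendsto (fun i => ‖residual f (hε i) - f‖ ^ 2) atTop (𝓝 0) := by
    simp only [ell2_norm_sq, hsub]
    have := tendsto_integral_of_dominated_convergence (μ := atomic a)
      (F := fun i k => clamp (ε i) (f k) ^ 2) (f := fun _ => 0) (fun k => f k ^ 2)
      (fun i => (measurable_pnat _).aestronglyMeasurable) (integrable_sq f)
      (fun i => ae_of_all _ fun k => ?_)
      (ae_of_all _ fun k => by simpa using (tendsto_clamp hε hε0 (f k)).pow 2)
    · simpa using this
    · rw [Real.norm_eq_abs, abs_of_nonneg (sq_nonneg _)]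
      have := abs_clamp_sub_le (ε i) (f k) 0
      rw [clamp_zero (hε i), sub_zero, sub_zero] at this
      exact sq_le_sq.2 this
  simpa using h.sqrt

/-- The difference is `-clamp (ε i) f`, which tends to `0` pointwise and has increments dominated by
those of `f`; dominated convergence applies to the energy series. -/
lemma tendsto_Q_residual_sub (ha : ∀ k, 0 < a k) {f : ell2 a} (hf : Q a f < ⊤)
    (hε : ∀ i, 0 ≤ ε i) (hε0 : Tendsto ε atTop (𝓝 0)) :
    Tendsto (fun i => Q a (residual f (hε i) - f)) atTop (𝓝 0) := by
  rw [Q_eq_energy] at hf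
  simp only [Q_eq_energy]
  refine tendsto_energy_zero hf (fun i k => ?_) fun k => ?_
  · rw [seq_sub ha]
    simp only [seq_residual ha]
    have := abs_clamp_sub_le (ε i) (seq f (k + 1)) (seq f k)
    rw [abs_sub_comm] at this
    convert this using 2
    ring
  · simp only [seq_sub ha, seq_residual ha]
    simpa using (tendsto_clamp hε hε0 (seq f k)).neg

end pointwise

/-! ### The measure `m` and local estimates for functions in `L²(m)`. -/

lemma measurable_density :
    Measurable fun x : ℝ => ENNReal.ofReal (2 * x ^ (3 - 1)) := by fun_prop

lemma ae_m {p : ℝ → Prop} : (∀ᵐ x ∂(m 3), p x) ↔ ∀ᵐ x, 0 < x → p x := by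
  rw [m, ae_withDensity_iff measurable_density, ae_restrict_iff' measurableSet_Ioi]
  refine eventually_congr (ae_of_all _ fun x => forall_congr' fun hx => ?_)
  have hx : 0 < x := hx
  have : ENNReal.ofReal (2 * x ^ (3 - 1)) ≠ 0 := by
    simp only [ne_eq, ENNReal.ofReal_eq_zero, not_le]
    positivity
  exact ⟨fun h => h this, fun h _ => h⟩

lemma density_lt_top (μ : Measure ℝ) : ∀ᵐ x ∂μ, ENNReal.ofReal (2 * x ^ (3 - 1)) < ⊤ :=
  ae_of_all _ fun _ => ENNReal.ofReal_lt_top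

lemma density_toReal (x : ℝ) : (ENNReal.ofReal (2 * x ^ (3 - 1))).toReal = 2 * x ^ 2 :=
  ENNReal.toReal_ofReal (mul_nonneg zero_le_two (sq_nonneg x))

lemma integral_m (g : ℝ → ℝ) : ∫ x, g x ∂(m 3) = ∫ x in Ioi (0 : ℝ), 2 * (g x * x ^ 2) := by
  rw [m, integral_withDensity_eq_integral_toReal_smul measurable_density (density_lt_top _)]
  refine integral_congr_ae (ae_of_all _ fun x => ?_)
  simp only [smul_eq_mul, density_toReal]
  ring

lemma integrable_m {g : ℝ → ℝ} :
    Integrable g (m 3) ↔ IntegrableOn (fun x => g x * x ^ 2) (Ioi 0) := by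
  rw [m, integrable_withDensity_iff_integrable_smul' measurable_density (density_lt_top _), IntegrableOn,
    ← integrable_const_mul_iff (c := (2 : ℝ)) (by simp) (fun x => g x * x ^ 2)]
  refine integrable_congr (ae_of_all _ fun x => ?_)
  simp only [smul_eq_mul, density_toReal]
  ring

lemma absolutelyContinuous_m : (volume.restrict (Ioi (0 : ℝ))) ≪ m 3 := by
  refine Measure.AbsolutelyContinuous.mk fun s hs h => ?_
  have h1 : ∀ᵐ x ∂(m 3), x ∉ s := measure_eq_zero_iff_ae_notMem.1 h
  replace h1 := (ae_restrict_iff' measurableSet_Ioi).2 (ae_m.1 h1)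
  exact measure_eq_zero_iff_ae_notMem.2 h1

lemma memLp_m_iff {g : ℝ → ℝ} (hg : AEStronglyMeasurable g (m 3)) :
    MemLp g 2 (m 3) ↔ IntegrableOn (fun x => g x ^ 2 * x ^ 2) (Ioi 0) := by
  rw [memLp_two_iff_integrable_sq hg, integrable_m]

lemma integrableOn_sq {g : ℝ → ℝ} (hg : MemLp g 2 (m 3)) :
    IntegrableOn (fun x => g x ^ 2 * x ^ 2) (Ioi 0) :=
  (memLp_m_iff hg.1).1 hg

lemma uIoc_subset_Ioi {x y : ℝ} (hx : 0 < x) (hy : 0 < y) : uIoc x y ⊆ Ioi 0 :=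
  fun _ ht => (lt_min hx hy).trans ht.1

lemma intervalIntegrable_sq {g : ℝ → ℝ} (hg : MemLp g 2 (m 3)) {x y : ℝ} (hx : 0 ≤ x)
    (hxy : x ≤ y) : IntervalIntegrable (fun t => g t ^ 2 * t ^ 2) volume x y := by
  rw [intervalIntegrable_iff, uIoc_of_le hxy]
  exact (integrableOn_sq hg).mono_set fun t ht => lt_of_le_of_lt hx ht.1

lemma intervalIntegrable_of_memLp {g : ℝ → ℝ} (hg : MemLp g 2 (m 3)) {x y : ℝ} (hx : 0 < x)
    (hy : 0 < y) : IntervalIntegrable g volume x y := by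
  rw [intervalIntegrable_iff]
  set z := min x y with hz
  have hz0 : 0 < z := lt_min hx hy
  have h1 : IntegrableOn (fun t => 1 + (z ^ 2)⁻¹ * (g t ^ 2 * t ^ 2)) (uIoc x y) :=
    Integrable.add (integrableOn_const (by simp [uIoc]))
      (((integrableOn_sq hg).mono_set (uIoc_subset_Ioi hx hy)).const_mul _)
  refine Integrable.mono' h1 ?_ ?_
  · exact (hg.1.mono_ac absolutelyContinuous_m).mono_measure
      (Measure.restrict_mono (uIoc_subset_Ioi hx hy) le_rfl)
  · refine (ae_restrict_iff' measurableSet_uIoc).2 (ae_of_all _ fun t ht => ?_)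
    have hzt : z ≤ t := ht.1.le
    have h2 : g t ^ 2 ≤ (z ^ 2)⁻¹ * (g t ^ 2 * t ^ 2) := by
      rw [le_inv_mul_iff₀ (by positivity), mul_comm]
      gcongr
    rw [Real.norm_eq_abs]
    have h3 : |g t| ≤ 1 + g t ^ 2 := by
      rw [← sq_abs]
      nlinarith [sq_nonneg (|g t| - 1), abs_nonneg (g t)]
    linarith

lemma integral_inv_sq {x y : ℝ} (hx : 0 < x) (hxy : x ≤ y) :
    ∫ t in x..y, (t ^ 2)⁻¹ = x⁻¹ - y⁻¹ := by
  have hpos : ∀ t ∈ uIcc x y, 0 < t := fun t ht => by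
    rw [uIcc_of_le hxy] at ht
    exact hx.trans_le ht.1
  have h := intervalIntegral.integral_eq_sub_of_hasDerivAt (a := x) (b := y)
    (f := fun t => -t⁻¹) (f' := fun t => (t ^ 2)⁻¹)
    (fun t ht => by simpa using (hasDerivAt_inv (hpos t ht).ne').fun_neg) ?_
  · rw [h]; ring
  · refine ContinuousOn.intervalIntegrable fun t ht => ?_
    have := (hpos t ht).ne'
    exact (ContinuousAt.inv₀ (by fun_prop) (by positivity)).continuousWithinAt

lemma intervalIntegrable_inv_sq {x y : ℝ} (hx : 0 < x) (hxy : x ≤ y) :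
    IntervalIntegrable (fun t => (t ^ 2)⁻¹) volume x y := by
  refine ContinuousOn.intervalIntegrable fun t ht => ?_
  rw [uIcc_of_le hxy] at ht
  have : 0 < t := hx.trans_le ht.1
  exact (ContinuousAt.inv₀ (by fun_prop) (by positivity)).continuousWithinAt

/-- The Cauchy–Schwarz inequality against the scale function of the Bessel form. -/
lemma sq_integral_le {g : ℝ → ℝ} (hg : MemLp g 2 (m 3)) {x y : ℝ} (hx : 0 < x) (hxy : x ≤ y) :
    (∫ t in x..y, g t) ^ 2 ≤ (x⁻¹ - y⁻¹) * ∫ t in x..y, g t ^ 2 * t ^ 2 := by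
  rcases hxy.eq_or_lt with rfl | hlt
  · simp
  have hD : 0 < x⁻¹ - y⁻¹ := sub_pos.2 (inv_strictAnti₀ hx hlt)
  set A := ∫ t in x..y, g t with hA
  set B := ∫ t in x..y, g t ^ 2 * t ^ 2 with hB
  -- The constant for which `c/t²` has the same integral as `g` over `[x, y]`; integrating `(g t * t
  -- - c/t)² ≥ 0` then gives the inequality.
  set c := A / (x⁻¹ - y⁻¹) with hc
  have hi1 := intervalIntegrable_sq hg hx.le hxy
  have hi2 := (intervalIntegrable_of_memLp hg hx (hx.trans hlt)).const_mul (2 * c)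
  have hi3 := (intervalIntegrable_inv_sq hx hxy).const_mul (c ^ 2)
  have h0 : 0 ≤ ∫ t in x..y, (g t ^ 2 * t ^ 2 - 2 * c * g t + c ^ 2 * (t ^ 2)⁻¹) := by
    refine intervalIntegral.integral_nonneg hxy fun t ht => ?_
    have ht0 : 0 < t := hx.trans_le ht.1
    have : g t ^ 2 * t ^ 2 - 2 * c * g t + c ^ 2 * (t ^ 2)⁻¹ = (g t * t - c * t⁻¹) ^ 2 := by
      field_simp
      ring
    rw [this]
    positivity
  rw [intervalIntegral.integral_add (hi1.sub hi2) hi3, intervalIntegral.integral_sub hi1 hi2,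
    intervalIntegral.integral_const_mul, intervalIntegral.integral_const_mul,
    integral_inv_sq hx hxy, ← hA, ← hB] at h0
  have hcD : c * (x⁻¹ - y⁻¹) = A := div_mul_cancel₀ _ hD.ne'
  have h1 : c * A ≤ B := by
    have : c ^ 2 * (x⁻¹ - y⁻¹) = c * A := by rw [← hcD]; ring
    linarith
  calc A ^ 2 = (x⁻¹ - y⁻¹) * (c * A) := by rw [← hcD]; ring
    _ ≤ _ := by gcongr

/-! ### The domain as a vector space -/

/-- Exhaustion of `(0,∞)` by the intervals `[1/(n+1), n+2]`. Each contains `1`, the base point of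
the primitives to which this is applied. -/
lemma ae_pos_of_forall_interval {p : ℝ → Prop}
    (h : ∀ x y, 0 < x → x ≤ 1 → 1 < y → ∀ᵐ t, t ∈ uIcc x y → p t) : ∀ᵐ t, 0 < t → p t := by
  have h' : ∀ n : ℕ, ∀ᵐ x, x ∈ uIcc (1 / ((n : ℝ) + 1)) ((n : ℝ) + 2) → p x := by
    intro n
    refine h _ _ (by positivity) ?_ (by linarith [n.cast_nonneg (α := ℝ)])
    rw [div_le_one (by positivity)]
    linarith [n.cast_nonneg (α := ℝ)]
  filter_upwards [ae_all_iff.2 h'] with x hx hx0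
  obtain ⟨n, hn⟩ := exists_nat_one_div_lt hx0
  obtain ⟨k, hk⟩ := exists_nat_ge x
  refine hx (max n k) ⟨?_, ?_⟩
  · refine inf_le_left.trans (le_trans ?_ hn.le)
    gcongr
    exact le_max_left _ _
  · refine le_trans ?_ le_sup_right
    have : (k : ℝ) ≤ (max n k : ℕ) := by exact_mod_cast le_max_right n k
    linarith

lemma LocAC.ae_differentiableAt {u : ℝ → ℝ} (hu : LocAC u) :
    ∀ᵐ x, 0 < x → DifferentiableAt ℝ u x :=
  ae_pos_of_forall_interval fun x y hx hx1 hy =>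
    (hu x y hx (hx1.trans_lt hy)).ae_differentiableAt

lemma LocAC.add {u v : ℝ → ℝ} (hu : LocAC u) (hv : LocAC v) : LocAC (u + v) :=
  fun x y hx hxy => (hu x y hx hxy).add (hv x y hx hxy)

lemma LocAC.smul {u : ℝ → ℝ} (c : ℝ) (hu : LocAC u) : LocAC (c • u) :=
  fun x y hx hxy => (hu x y hx hxy).const_smul c

lemma LocAC.deriv_add {u v : ℝ → ℝ} (hu : LocAC u) (hv : LocAC v) :
    deriv (u + v) =ᵐ[m 3] deriv u + deriv v := by
  refine ae_m.2 ?_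
  filter_upwards [hu.ae_differentiableAt, hv.ae_differentiableAt] with x h1 h2 hx
  exact _root_.deriv_add (h1 hx) (h2 hx)

lemma LocAC.deriv_smul {u : ℝ → ℝ} (c : ℝ) (hu : LocAC u) :
    deriv (c • u) =ᵐ[m 3] c • deriv u := by
  refine ae_m.2 ?_
  filter_upwards [hu.ae_differentiableAt] with x h1 hx
  exact deriv_const_smul c (h1 hx)

lemma LocAC.continuousOn {u : ℝ → ℝ} (hu : LocAC u) : ContinuousOn u (Ioi 0) := by
  intro x hx
  have hx : 0 < x := hx
  have h := (hu (x / 2) (x + 1) (by positivity) (by linarith)).continuousOn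
  refine (h.continuousAt ?_).continuousWithinAt
  rw [uIcc_of_le (by linarith)]
  exact Icc_mem_nhds (by linarith) (by linarith)

lemma LocAC.integral_deriv {u : ℝ → ℝ} (hu : LocAC u) {x y : ℝ} (hx : 0 < x) (hy : 0 < y) :
    ∫ t in x..y, deriv u t = u y - u x := by
  rcases lt_trichotomy x y with h | rfl | h
  · exact (hu x y hx h).integral_deriv_eq_sub
  · simp
  · exact (hu y x hy h).symm.integral_deriv_eq_sub

lemma memLp_deriv_iff {u : ℝ → ℝ} : MemLp (deriv u) 2 (m 3) ↔
    IntegrableOn (fun x => deriv u x ^ 2 * x ^ (3 - 1)) (Ioi 0) :=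
  memLp_m_iff (measurable_deriv u).aestronglyMeasurable

lemma mem_domain_iff {u : ℝ → ℝ} :
    u ∈ domain 3 ↔ LocAC u ∧ MemLp (deriv u) 2 (m 3) ∧ MemLp u 2 (m 3) := by
  rw [memLp_deriv_iff]
  rfl

/-- The domain of the form as a vector space of functions. -/
def domainSubmodule : Submodule ℝ (ℝ → ℝ) where
  carrier := domain 3
  zero_mem' := by
    refine mem_domain_iff.2 ⟨fun x y _ _ => ?_, ?_, MemLp.zero⟩
    · exact contDiffOn_const.absolutelyContinuousOnInterval
    · simp
  add_mem' {u v} hu hv := by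
    rw [mem_domain_iff] at *
    exact ⟨hu.1.add hv.1, (memLp_congr_ae (hu.1.deriv_add hv.1)).2 (hu.2.1.add hv.2.1),
      hu.2.2.add hv.2.2⟩
  smul_mem' c u hu := by
    rw [mem_domain_iff] at *
    exact ⟨hu.1.smul c, (memLp_congr_ae (hu.1.deriv_smul c)).2 (hu.2.1.const_smul c),
      hu.2.2.const_smul c⟩

lemma locAC_mem (u : domainSubmodule) : LocAC u := (mem_domain_iff.1 u.2).1

lemma memLp_deriv_mem (u : domainSubmodule) : MemLp (deriv (u : ℝ → ℝ)) 2 (m 3) :=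
  (mem_domain_iff.1 u.2).2.1

lemma memLp_mem (u : domainSubmodule) : MemLp (u : ℝ → ℝ) 2 (m 3) := (mem_domain_iff.1 u.2).2.2

/-! ### Hilbert space realisation of the form. -/

/-- The Hilbert space in which the domain is embedded by a function and its derivative. -/
abbrev Graph := WithLp 2 (Lp ℝ 2 (m 3) × Lp ℝ 2 (m 3))

/-- The map `u ↦ (√lam u, √(1/2) u')`, which carries `formAt 3 lam` to the inner product. -/
def embed (lam : ℝ) : domainSubmodule →ₗ[ℝ] Graph where
  toFun u := WithLp.toLp 2 (√lam • (memLp_mem u).toLp _, √(1 / 2) • (memLp_deriv_mem u).toLp _)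
  map_add' u v := by
    have h : (memLp_deriv_mem (u + v)).toLp _ =
        (memLp_deriv_mem u).toLp _ + (memLp_deriv_mem v).toLp _ := by
      rw [← MemLp.toLp_add]
      exact MemLp.toLp_congr _ _ ((locAC_mem u).deriv_add (locAC_mem v))
    have h2 : (memLp_mem (u + v)).toLp _ = (memLp_mem u).toLp _ + (memLp_mem v).toLp _ := rfl
    rw [h, h2, smul_add, smul_add, ← WithLp.toLp_add, Prod.mk_add_mk]
  map_smul' c u := by
    have h : (memLp_deriv_mem (c • u)).toLp _ = c • (memLp_deriv_mem u).toLp _ := by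
      rw [← MemLp.toLp_const_smul]
      exact MemLp.toLp_congr _ _ ((locAC_mem u).deriv_smul c)
    have h2 : (memLp_mem (c • u)).toLp _ = c • (memLp_mem u).toLp _ := rfl
    rw [h, h2, RingHom.id_apply, smul_comm, smul_comm _ c, ← WithLp.toLp_smul, Prod.smul_mk]

lemma inner_toLp {f g : ℝ → ℝ} (hf : MemLp f 2 (m 3)) (hg : MemLp g 2 (m 3)) :
    inner ℝ (hf.toLp f) (hg.toLp g) = ∫ x, f x * g x ∂(m 3) := by
  rw [L2.inner_def]
  refine integral_congr_ae ?_
  filter_upwards [hf.coeFn_toLp, hg.coeFn_toLp] with x h1 h2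
  rw [h1, h2]
  simp [mul_comm]

/-- The weight `1/2` on the derivative component compensates for `m` having density `2x²` while the
form integrates against `x²`. -/
lemma formAt_eq_inner {lam : ℝ} (hlam : 0 ≤ lam) (u v : domainSubmodule) :
    formAt 3 lam u v = inner ℝ (embed lam u) (embed lam v) := by
  simp only [embed, LinearMap.coe_mk, AddHom.coe_mk, WithLp.prod_inner_apply, inner_smul_left,
    inner_smul_right, inner_toLp, formAt, form, conj_trivial]
  rw [← mul_assoc, ← mul_assoc, Real.mul_self_sqrt hlam, Real.mul_self_sqrt (by norm_num),
    integral_m (fun x => deriv (u : ℝ → ℝ) x * deriv (v : ℝ → ℝ) x), integral_const_mul]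
  norm_num
  ring

/-! ### Primitives of functions in `L²(m)` and their convergence. -/

lemma locAC_primitive {g : ℝ → ℝ} (hg : MemLp g 2 (m 3)) (c : ℝ) :
    LocAC fun x => c + ∫ t in (1 : ℝ)..x, g t := by
  intro x y hx hxy
  have hx1 : 0 < min x 1 := lt_min hx one_pos
  have hy1 : 0 < max y 1 := lt_max_of_lt_right one_pos
  have h := (intervalIntegrable_of_memLp hg hx1 hy1).absolutelyContinuousOnInterval_intervalIntegral
    (c := 1) (by rw [mem_uIcc]; left; exact ⟨min_le_right _ _, le_max_right _ _⟩)
  have hc : AbsolutelyContinuousOnInterval (fun _ : ℝ => c) x y :=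
    contDiffOn_const.absolutelyContinuousOnInterval
  refine hc.add (h.mono ?_)
  rw [uIcc_of_le hxy.le, uIcc_of_le ((min_le_right _ _).trans (le_max_right _ _))]
  exact Icc_subset_Icc (min_le_left _ _) (le_max_left _ _)

lemma deriv_primitive {g : ℝ → ℝ} (hg : MemLp g 2 (m 3)) (c : ℝ) :
    deriv (fun x => c + ∫ t in (1 : ℝ)..x, g t) =ᵐ[m 3] g := by
  refine ae_m.2 (ae_pos_of_forall_interval fun x y hx hx1 hy => ?_)
  filter_upwards [(intervalIntegrable_of_memLp hg hx (one_pos.trans hy)).ae_hasDerivAt_integral]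
    with t ht htm
  exact ((ht htm 1 (by rw [mem_uIcc]; left; exact ⟨hx1, hy.le⟩)).const_add c).deriv

lemma integral_Ioi_eq_norm_sq {g : ℝ → ℝ} (hg : MemLp g 2 (m 3)) :
    ∫ t in Ioi (0 : ℝ), g t ^ 2 * t ^ 2 = ‖hg.toLp g‖ ^ 2 / 2 := by
  rw [← real_inner_self_eq_norm_sq, inner_toLp, integral_m (fun x => g x * g x),
    integral_const_mul, mul_div_cancel_left₀ _ two_ne_zero]
  simp only [pow_two]

lemma integral_interval_le {g : ℝ → ℝ} (hg : MemLp g 2 (m 3)) {x y : ℝ} (hx : 0 ≤ x)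
    (hxy : x ≤ y) :
    ∫ t in x..y, g t ^ 2 * t ^ 2 ≤ ∫ t in Ioi (0 : ℝ), g t ^ 2 * t ^ 2 := by
  rw [intervalIntegral.integral_of_le hxy]
  refine setIntegral_mono_set (integrableOn_sq hg) (ae_of_all _ fun t => by positivity) ?_
  exact ae_of_all _ fun t ht => lt_of_le_of_lt hx ht.1

lemma abs_integral_le_norm {g : ℝ → ℝ} (hg : MemLp g 2 (m 3)) {x y : ℝ} (hx : 0 < x)
    (hxy : x ≤ y) : |∫ t in x..y, g t| ≤ √(x⁻¹ * (‖hg.toLp g‖ ^ 2 / 2)) := by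
  refine Real.abs_le_sqrt ((sq_integral_le hg hx hxy).trans ?_)
  have h0 : 0 ≤ ∫ t in x..y, g t ^ 2 * t ^ 2 :=
    intervalIntegral.integral_nonneg hxy fun t _ => by positivity
  have h1 := integral_interval_le hg hx.le hxy
  rw [integral_Ioi_eq_norm_sq hg] at h1
  have h2 : 0 ≤ y⁻¹ := inv_nonneg.2 (hx.le.trans hxy)
  have h3 : 0 ≤ x⁻¹ := inv_nonneg.2 hx.le
  calc _ ≤ x⁻¹ * ∫ t in x..y, g t ^ 2 * t ^ 2 := by gcongr; linarith
    _ ≤ _ := by gcongr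

lemma tendsto_integral_of_le {G : ℕ → Lp ℝ 2 (m 3)} {g : Lp ℝ 2 (m 3)}
    (h : Tendsto G atTop (𝓝 g)) {x y : ℝ} (hx : 0 < x) (hxy : x ≤ y) :
    Tendsto (fun i => ∫ t in x..y, G i t) atTop (𝓝 (∫ t in x..y, g t)) := by
  have hy := hx.trans_le hxy
  rw [tendsto_iff_norm_sub_tendsto_zero] at h ⊢
  have hlim : Tendsto (fun i => √(x⁻¹ * (‖G i - g‖ ^ 2 / 2))) atTop (𝓝 0) := by
    simpa using (((h.pow 2).div_const 2).const_mul x⁻¹).sqrt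
  refine squeeze_zero (fun _ => norm_nonneg _) (fun i => ?_) hlim
  rw [← intervalIntegral.integral_sub (intervalIntegrable_of_memLp (Lp.memLp _) hx hy)
    (intervalIntegrable_of_memLp (Lp.memLp _) hx hy)]
  have := abs_integral_le_norm ((Lp.memLp (G i)).sub (Lp.memLp g)) hx hxy
  rwa [MemLp.toLp_sub (Lp.memLp (G i)) (Lp.memLp g), Lp.toLp_coeFn, Lp.toLp_coeFn] at this

lemma tendsto_integral_of_tendsto {G : ℕ → Lp ℝ 2 (m 3)} {g : Lp ℝ 2 (m 3)}
    (h : Tendsto G atTop (𝓝 g)) {x y : ℝ} (hx : 0 < x) (hy : 0 < y) :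
    Tendsto (fun i => ∫ t in x..y, G i t) atTop (𝓝 (∫ t in x..y, g t)) := by
  rcases le_total x y with hxy | hxy
  · exact tendsto_integral_of_le h hx hxy
  · simp only [intervalIntegral.integral_symm y x]
    exact (tendsto_integral_of_le h hy hxy).neg

/-! ### The kernel of `J` and the projection off it. -/

/-- The kernel of `J` as a subspace of the domain. -/
def kerSubmodule : Submodule ℝ domainSubmodule where
  carrier := {u | ∀ k : ℕ+, (u : ℝ → ℝ) k = 0}
  zero_mem' := fun _ => rfl
  add_mem' {u v} hu hv k := by
    show (u : ℝ → ℝ) k + (v : ℝ → ℝ) k = 0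
    rw [hu k, hv k, add_zero]
  smul_mem' c u hu k := by
    show c * (u : ℝ → ℝ) k = 0
    rw [hu k, mul_zero]

lemma mem_kerJ_iff (u : domainSubmodule) : (u : ℝ → ℝ) ∈ kerJ 3 ↔ u ∈ kerSubmodule :=
  ⟨fun h => h.2, fun h => ⟨u.2, h⟩⟩

/-- A limit point is a pair, up to scaling, of a function `F` and a derivative `G`. The primitive
`U` of `G` is the pointwise limit of the kernel functions, so it vanishes at the integers, and an
almost everywhere convergent subsequence identifies it with `F`. -/
lemma isClosed_map_kerSubmodule {lam : ℝ} (hlam : 0 < lam) :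
    IsClosed ((kerSubmodule.map (embed lam) : Submodule ℝ Graph) : Set Graph) := by
  refine isSeqClosed_iff_isClosed.1 fun x p hx hp => ?_
  choose v hv hvx using hx
  have hs : √lam ≠ 0 := (Real.sqrt_pos.2 hlam).ne'
  have hs2 : √(1 / 2 : ℝ) ≠ 0 := (Real.sqrt_pos.2 (by norm_num)).ne'
  set F : Lp ℝ 2 (m 3) := (√lam)⁻¹ • p.fst with hF
  set G : Lp ℝ 2 (m 3) := (√(1 / 2))⁻¹ • p.snd with hG
  have hF' : Tendsto (fun i => (memLp_mem (v i)).toLp _) atTop (𝓝 F) := by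
    have h := (((WithLp.continuous_fst 2 _ _).tendsto p).comp hp).const_smul (√lam)⁻¹
    refine h.congr fun i => ?_
    simp only [Function.comp_apply, ← hvx i]
    simp only [embed, LinearMap.coe_mk, AddHom.coe_mk, WithLp.fst]
    rw [smul_smul, inv_mul_cancel₀ hs, one_smul]
  have hG' : Tendsto (fun i => (memLp_deriv_mem (v i)).toLp _) atTop (𝓝 G) := by
    have h := (((WithLp.continuous_snd 2 _ _).tendsto p).comp hp).const_smul (√(1 / 2 : ℝ))⁻¹
    refine h.congr fun i => ?_
    simp only [Function.comp_apply, ← hvx i]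
    simp only [embed, LinearMap.coe_mk, AddHom.coe_mk, WithLp.snd]
    rw [smul_smul, inv_mul_cancel₀ hs2, one_smul]
  -- The value at the base point `1` is `0` because all functions of the kernel vanish there.
  set U : ℝ → ℝ := fun x => 0 + ∫ t in (1 : ℝ)..x, G t with hU
  have hconv : ∀ x, 0 < x → Tendsto (fun i => (v i : ℝ → ℝ) x) atTop (𝓝 (U x)) := by
    intro x hx
    have h := tendsto_integral_of_tendsto hG' one_pos hx
    rw [hU]
    simp only [zero_add]
    refine h.congr fun i => ?_
    have h1 : (v i : ℝ → ℝ) 1 = 0 := by simpa using hv i 1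
    rw [← sub_zero ((v i : ℝ → ℝ) x), ← h1, ← (locAC_mem (v i)).integral_deriv one_pos hx]
    have hae := ae_m.1 (memLp_deriv_mem (v i)).coeFn_toLp
    refine intervalIntegral.integral_congr_ae ?_
    filter_upwards [hae] with t ht htm
    exact ht (uIoc_subset_Ioi one_pos hx htm)
  have hFU : F =ᵐ[m 3] U := by
    obtain ⟨ns, hns, hae⟩ := (tendstoInMeasure_of_tendsto_Lp hF').exists_seq_tendsto_ae
    have h1 : ∀ᵐ x ∂(m 3), ∀ i, (memLp_mem (v i)).toLp _ x = (v i : ℝ → ℝ) x :=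
      ae_all_iff.2 fun i => (memLp_mem (v i)).coeFn_toLp
    have h2 : ∀ᵐ x ∂(m 3), 0 < x := ae_m.2 (ae_of_all _ fun _ h => h)
    filter_upwards [hae, h1, h2] with x hx hx1 hx2
    simp only [hx1] at hx
    exact tendsto_nhds_unique hx ((hconv x hx2).comp hns.tendsto_atTop)
  have hder : deriv U =ᵐ[m 3] G := deriv_primitive (Lp.memLp G) 0
  have hUdom : U ∈ domain 3 := mem_domain_iff.2 ⟨locAC_primitive (Lp.memLp G) 0,
    (memLp_congr_ae hder).2 (Lp.memLp G), (memLp_congr_ae hFU).1 (Lp.memLp F)⟩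
  refine ⟨⟨U, hUdom⟩, fun k => ?_, ?_⟩
  · have hk : (0 : ℝ) < (k : ℝ) := by exact_mod_cast k.pos
    refine tendsto_nhds_unique (hconv k hk) ?_
    simp only [hv _ k]
    exact tendsto_const_nhds
  · have e1 : (memLp_mem ⟨U, hUdom⟩).toLp _ = F := by
      rw [← Lp.toLp_coeFn F (Lp.memLp F)]
      exact MemLp.toLp_congr _ _ hFU.symm
    have e2 : (memLp_deriv_mem ⟨U, hUdom⟩).toLp _ = G := by
      rw [← Lp.toLp_coeFn G (Lp.memLp G)]
      exact MemLp.toLp_congr _ _ hder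
    simp only [embed, LinearMap.coe_mk, AddHom.coe_mk, e1, e2]
    rw [hF, hG, smul_smul, smul_smul, mul_inv_cancel₀ hs, mul_inv_cancel₀ hs2, one_smul, one_smul]
    rfl

lemma mem_kerJOrth_iff {lam : ℝ} (hlam : 0 ≤ lam) (w : domainSubmodule) :
    (w : ℝ → ℝ) ∈ kerJOrth 3 lam ↔ ∀ v ∈ kerSubmodule, inner ℝ (embed lam w) (embed lam v) = 0 := by
  constructor
  · intro h v hv
    rw [← formAt_eq_inner hlam]
    exact h.2 v ((mem_kerJ_iff v).2 hv)
  · intro h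
    refine ⟨w.2, fun v hv => ?_⟩
    have := h ⟨v, hv.1⟩ ((mem_kerJ_iff _).1 hv)
    rwa [← formAt_eq_inner hlam] at this

/-- Existence of the projection onto the orthogonal complement of `ker J`, with the same values on
the positive integers. -/
lemma exists_isProj {lam : ℝ} (hlam : 0 < lam) (u : domainSubmodule) :
    ∃ w : domainSubmodule, u - w ∈ kerSubmodule ∧ IsProj 3 lam u w := by
  have : CompleteSpace (kerSubmodule.map (embed lam) : Submodule ℝ Graph) :=
    (isClosed_map_kerSubmodule hlam).completeSpace_coe
  -- Completeness of the whole domain is not needed: `u` is projected onto the image of the kernel,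
  -- and the difference is the required projection.
  obtain ⟨y, hy, hyu⟩ := (kerSubmodule.map (embed lam)).exists_norm_eq_iInf_of_complete_subspace
    (isClosed_map_kerSubmodule hlam).isComplete (embed lam u)
  rw [Submodule.norm_eq_iInf_iff_real_inner_eq_zero _ hy] at hyu
  obtain ⟨v, hv, rfl⟩ := hy
  have hw : ((u - v : domainSubmodule) : ℝ → ℝ) ∈ kerJOrth 3 lam := by
    rw [mem_kerJOrth_iff hlam.le]
    intro z hz
    rw [map_sub]
    exact hyu _ ⟨z, hz, rfl⟩
  refine ⟨u - v, by rwa [sub_sub_cancel], hw, fun z hz => ?_⟩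
  have h1 := formAt_eq_inner hlam.le (u - (u - v)) ⟨z, hz.1⟩
  rw [sub_sub_cancel, real_inner_comm, (mem_kerJOrth_iff hlam.le ⟨z, hz.1⟩).1 hz v hv] at h1
  rw [← h1]
  congr 1
  ext x
  simp

lemma IsProj.mem_domain {lam : ℝ} {u w : ℝ → ℝ} (h : IsProj 3 lam u w) : w ∈ domain 3 := h.1.1

/-- The difference `w - w'` lies in the complement and is a combination of `u - u'`, `u - w` and `u'
- w'`, each orthogonal to the complement. It is thus orthogonal to itself. -/
lemma IsProj.formAt_eq {lam : ℝ} (hlam : 0 ≤ lam) {u u' w w' : domainSubmodule}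
    (h : IsProj 3 lam u w) (h' : IsProj 3 lam u' w') (hu : u - u' ∈ kerSubmodule) :
    formAt 3 lam w w = formAt 3 lam w' w' := by
  have hd : ((w - w' : domainSubmodule) : ℝ → ℝ) ∈ kerJOrth 3 lam := by
    rw [mem_kerJOrth_iff hlam]
    intro v hv
    rw [map_sub, inner_sub_left, (mem_kerJOrth_iff hlam _).1 h.1 v hv,
      (mem_kerJOrth_iff hlam _).1 h'.1 v hv, sub_zero]
  have e1 : inner ℝ (embed lam (u - w)) (embed lam (w - w')) = 0 := by
    rw [← formAt_eq_inner hlam]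
    exact h.2 _ hd
  have e2 : inner ℝ (embed lam (u' - w')) (embed lam (w - w')) = 0 := by
    rw [← formAt_eq_inner hlam]
    exact h'.2 _ hd
  have e3 := (mem_kerJOrth_iff hlam _).1 hd _ hu
  rw [real_inner_comm] at e3
  have e4 : inner ℝ (embed lam (w - w')) (embed lam (w - w')) = 0 := by
    have : w - w' = (u - u') - (u - w) + (u' - w') := by abel
    nth_rewrite 1 [this]
    rw [map_add, map_sub, inner_add_left, inner_sub_left, e1, e2, e3]
    simp
  have e5 : embed lam w = embed lam w' := by
    rw [inner_self_eq_zero, map_sub, sub_eq_zero] at e4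
    exact e4
  rw [formAt_eq_inner hlam, formAt_eq_inner hlam, e5]

/-- Pythagoras: the projection minimises the form among functions with the same values at the
integers. -/
lemma formAt_proj_le {lam : ℝ} (hlam : 0 ≤ lam) {w h : domainSubmodule}
    (hw : (w : ℝ → ℝ) ∈ kerJOrth 3 lam) (hh : h - w ∈ kerSubmodule) :
    formAt 3 lam w w ≤ formAt 3 lam h h := by
  have e := (mem_kerJOrth_iff hlam _).1 hw _ hh
  have : h = w + (h - w) := by abel
  rw [formAt_eq_inner hlam, formAt_eq_inner hlam, this, map_add, real_inner_add_add_self, e]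
  have := real_inner_self_nonneg (x := embed lam (h - w))
  linarith

/-! ### Restriction of a function of the domain to the integers. -/

lemma form_self (u : ℝ → ℝ) : form 3 u u = ∫ t in Ioi (0 : ℝ), deriv u t ^ 2 * t ^ 2 := by
  simp only [form, pow_two, Nat.reduceSub]

/-- `sq_integral_le` on each `[k+1, k+2]`, where the scale increment is `1/((k+1)(k+2))`, followed
by summation. -/
lemma energy_le_form (u : domainSubmodule) :
    energy (fun k => (u : ℝ → ℝ) (k + 1)) ≤ ENNReal.ofReal (form 3 u u) := by
  refine ENNReal.tsum_le_of_sum_range_le fun n => ?_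
  rw [← ENNReal.ofReal_sum_of_nonneg fun k _ => by positivity]
  refine ENNReal.ofReal_le_ofReal ?_
  have hu := memLp_deriv_mem u
  have hterm : ∀ k : ℕ, ((k : ℝ) + 1) * ((k : ℝ) + 2) *
      ((u : ℝ → ℝ) ((k + 1 : ℕ) + 1) - (u : ℝ → ℝ) (k + 1)) ^ 2 ≤
      ∫ t in ((k : ℝ) + 1)..((k + 1 : ℕ) + 1), deriv (u : ℝ → ℝ) t ^ 2 * t ^ 2 := by
    intro k
    have hk : (0 : ℝ) < (k : ℝ) + 1 := by positivity
    have hk2 : (k : ℝ) + 1 ≤ ((k + 1 : ℕ) : ℝ) + 1 := by push_cast; linarith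
    have h := sq_integral_le hu hk hk2
    rw [(locAC_mem u).integral_deriv hk (hk.trans_le hk2)] at h
    have e : ((k : ℝ) + 1) * ((k : ℝ) + 2) * (((k : ℝ) + 1)⁻¹ - (((k + 1 : ℕ) : ℝ) + 1)⁻¹) = 1 := by
      push_cast
      field_simp
      ring
    calc _ ≤ ((k : ℝ) + 1) * ((k : ℝ) + 2) * ((((k : ℝ) + 1)⁻¹ - (((k + 1 : ℕ) : ℝ) + 1)⁻¹) *
          ∫ t in ((k : ℝ) + 1)..((k + 1 : ℕ) + 1), deriv (u : ℝ → ℝ) t ^ 2 * t ^ 2) := by gcongr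
      _ = _ := by rw [← mul_assoc, e, one_mul]
  refine (Finset.sum_le_sum fun k _ => hterm k).trans ?_
  rw [intervalIntegral.sum_integral_adjacent_intervals (a := fun k : ℕ => (k : ℝ) + 1)
    fun k _ => intervalIntegrable_sq hu (by positivity) (by push_cast; linarith), form_self]
  exact integral_interval_le hu (by positivity) (by simp)

lemma tendsto_zero_of_mem_domain (u : domainSubmodule) :
    Tendsto (fun k : ℕ => (u : ℝ → ℝ) (k + 1)) atTop (𝓝 0) := by
  have hu := memLp_deriv_mem u
  obtain ⟨c, hc⟩ := exists_tendsto_of_energy ((energy_le_form u).trans_lt ENNReal.ofReal_lt_top)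
  by_cases hc0 : c = 0
  · rwa [hc0] at hc
  exfalso
  have hcpos : 0 < |c| := abs_pos.2 hc0
  set B := ∫ t in Ioi (0 : ℝ), deriv (u : ℝ → ℝ) t ^ 2 * t ^ 2
  have h1 : ∀ᶠ k : ℕ in atTop, |c| / 2 < |(u : ℝ → ℝ) (k + 1)| :=
    hc.abs.eventually_const_lt (by linarith)
  have h2 : ∀ᶠ k : ℕ in atTop, B / ((k : ℝ) + 1) < (|c| / 4) ^ 2 :=
    (tendsto_energy_div B).eventually_lt_const (by positivity)
  obtain ⟨k, hk1, hk2⟩ := (h1.and h2).exists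
  have hk : (0 : ℝ) < (k : ℝ) + 1 := by positivity
  -- At `k + 1` the modulus exceeds `|c|/2`, and beyond it `u` moves by at most `|c|/4`. Such a
  -- lower bound on a half-line is incompatible with `u ∈ L²(m)`.
  have hlow : ∀ x : ℝ, (k : ℝ) + 1 ≤ x → |c| / 4 ≤ |(u : ℝ → ℝ) x| := by
    intro x hx
    have hx0 := hk.trans_le hx
    have h := sq_integral_le hu hk hx
    rw [(locAC_mem u).integral_deriv hk hx0] at h
    have h0 : 0 ≤ ∫ t in ((k : ℝ) + 1)..x, deriv (u : ℝ → ℝ) t ^ 2 * t ^ 2 :=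
      intervalIntegral.integral_nonneg hx fun t _ => by positivity
    have h3 := integral_interval_le hu hk.le hx
    have h4 : ((u : ℝ → ℝ) x - (u : ℝ → ℝ) (k + 1)) ^ 2 ≤ (|c| / 4) ^ 2 := by
      refine (h.trans ?_).trans hk2.le
      rw [div_eq_inv_mul]
      have : 0 ≤ x⁻¹ := by positivity
      calc _ ≤ ((k : ℝ) + 1)⁻¹ * ∫ t in ((k : ℝ) + 1)..x, deriv (u : ℝ → ℝ) t ^ 2 * t ^ 2 := by
            gcongr; linarith
        _ ≤ _ := by gcongr
    have h5 := abs_le_of_sq_le_sq h4 (by positivity)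
    have h6 := abs_sub_abs_le_abs_sub ((u : ℝ → ℝ) (k + 1)) ((u : ℝ → ℝ) x)
    rw [abs_sub_comm] at h6
    linarith
  have hint := (integrableOn_sq (memLp_mem u)).mono_set
    (Ici_subset_Ioi.2 hk : Ici ((k : ℝ) + 1) ⊆ Ioi 0)
  have hconst : IntegrableOn (fun _ : ℝ => (|c| / 4) ^ 2) (Ici ((k : ℝ) + 1)) := by
    refine Integrable.mono hint aestronglyMeasurable_const ?_
    refine (ae_restrict_iff' measurableSet_Ici).2 (ae_of_all _ fun x hx => ?_)
    rw [Real.norm_of_nonneg (by positivity), Real.norm_of_nonneg (by positivity),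
      ← sq_abs ((u : ℝ → ℝ) x)]
    have hx1 : 1 ≤ x := le_trans (by linarith [k.cast_nonneg (α := ℝ)]) (mem_Ici.1 hx)
    calc (|c| / 4) ^ 2 ≤ |(u : ℝ → ℝ) x| ^ 2 := by
          have := hlow x hx
          gcongr
      _ ≤ _ := le_mul_of_one_le_right (by positivity) (one_le_pow₀ hx1)
  rw [integrableOn_const_iff (by finiteness)] at hconst
  rcases hconst with h | h
  · have : 0 < (|c| / 4) ^ 2 := by positivity
    exact this.ne' (enorm_eq_zero.1 h)
  · simp at h

/-! ### The harmonic extension of a finitely supported sequence -/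

/-- The flux `x² u'(x)` of the harmonic extension on `(j, j+1)`. -/
def flux (v : ℕ → ℝ) : ℕ → ℝ
  | 0 => 0
  | k + 1 => ((k : ℝ) + 1) * ((k : ℝ) + 2) * (v (k + 1) - v k)

/-- The derivative of the harmonic extension. -/
def extDeriv (v : ℕ → ℝ) (t : ℝ) : ℝ := flux v ⌊t⌋₊ * (t ^ 2)⁻¹

lemma measurable_extDeriv (v : ℕ → ℝ) : Measurable (extDeriv v) := by
  unfold extDeriv
  have : Measurable fun t : ℝ => flux v ⌊t⌋₊ :=
    (measurable_from_top (f := flux v)).comp Nat.measurable_floor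
  fun_prop

/-- The interval contains its right endpoint, where the floor jumps; that point is null. -/
lemma ae_floor_eq (k : ℕ) : ∀ᵐ t : ℝ, t ∈ uIoc (k : ℝ) ((k + 1 : ℕ) : ℝ) → ⌊t⌋₊ = k := by
  have h : ∀ᵐ t : ℝ, t ≠ ((k + 1 : ℕ) : ℝ) := by simp [ae_iff, measure_singleton]
  filter_upwards [h] with t ht htm
  rw [uIoc_of_le (by push_cast; linarith)] at htm
  have h1 : t < (k + 1 : ℕ) := lt_of_le_of_ne htm.2 ht
  rw [Nat.floor_eq_iff ((Nat.cast_nonneg k).trans htm.1.le)]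
  exact ⟨htm.1.le, by exact_mod_cast h1⟩

lemma extDeriv_sq_ae (v : ℕ → ℝ) (k : ℕ) :
    ∀ᵐ t : ℝ, t ∈ uIoc (k : ℝ) ((k + 1 : ℕ) : ℝ) →
      flux v k ^ 2 * (t ^ 2)⁻¹ = extDeriv v t ^ 2 * t ^ 2 := by
  filter_upwards [ae_floor_eq k] with t ht htm
  rw [extDeriv, ht htm]
  rw [uIoc_of_le (by push_cast; linarith)] at htm
  have : t ≠ 0 := ((Nat.cast_nonneg k).trans_lt htm.1).ne'
  field_simp

lemma intervalIntegrable_extDeriv_sq (v : ℕ → ℝ) (k : ℕ) :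
    IntervalIntegrable (fun t => extDeriv v t ^ 2 * t ^ 2) volume (k : ℝ) ((k + 1 : ℕ) : ℝ) := by
  have h : IntervalIntegrable (fun t : ℝ => flux v k ^ 2 * (t ^ 2)⁻¹) volume
      (k : ℝ) ((k + 1 : ℕ) : ℝ) := by
    -- On the first interval `t⁻²` is not integrable at `0`; the vanishing flux there removes the
    -- singularity.
    rcases k with _ | k
    · simp [flux]
    · exact (intervalIntegrable_inv_sq (by positivity) (by push_cast; linarith)).const_mul _
  exact h.congr_ae ((ae_restrict_iff' measurableSet_uIoc).2 (extDeriv_sq_ae v k))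

lemma integral_extDeriv_sq (v : ℕ → ℝ) (k : ℕ) :
    ∫ t in ((k + 1 : ℕ) : ℝ)..((k + 1 + 1 : ℕ) : ℝ), extDeriv v t ^ 2 * t ^ 2 =
      ((k : ℝ) + 1) * ((k : ℝ) + 2) * (v (k + 1) - v k) ^ 2 := by
  rw [← intervalIntegral.integral_congr_ae (extDeriv_sq_ae v (k + 1)),
    intervalIntegral.integral_const_mul,
    integral_inv_sq (by positivity) (by push_cast; linarith), flux]
  push_cast
  field_simp
  ring

lemma integral_extDeriv (v : ℕ → ℝ) (k : ℕ) :
    ∫ t in ((k + 1 : ℕ) : ℝ)..((k + 1 + 1 : ℕ) : ℝ), extDeriv v t = v (k + 1) - v k := by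
  have h : ∫ t in ((k + 1 : ℕ) : ℝ)..((k + 1 + 1 : ℕ) : ℝ), extDeriv v t =
      ∫ t in ((k + 1 : ℕ) : ℝ)..((k + 1 + 1 : ℕ) : ℝ), flux v (k + 1) * (t ^ 2)⁻¹ := by
    refine intervalIntegral.integral_congr_ae ?_
    filter_upwards [ae_floor_eq (k + 1)] with t ht htm
    rw [extDeriv, ht htm]
  rw [h, intervalIntegral.integral_const_mul,
    integral_inv_sq (by positivity) (by push_cast; linarith), flux]
  push_cast
  field_simp
  ring

section finite

variable {v : ℕ → ℝ} {N : ℕ}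

lemma flux_eq_zero (hv : ∀ k ≥ N, v k = 0) {j : ℕ} (hj : N + 1 ≤ j) : flux v j = 0 := by
  obtain ⟨k, rfl⟩ : ∃ k, j = k + 1 := ⟨j - 1, by omega⟩
  rw [flux, hv k (by omega), hv (k + 1) (by omega), sub_self, mul_zero]

lemma extDeriv_eq_zero (hv : ∀ k ≥ N, v k = 0) {t : ℝ} (ht : ((N + 1 : ℕ) : ℝ) ≤ t) :
    extDeriv v t = 0 := by
  rw [extDeriv, flux_eq_zero hv (Nat.le_floor ht), zero_mul]

lemma intervalIntegrable_extDeriv_sq_zero (v : ℕ → ℝ) (n : ℕ) :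
    IntervalIntegrable (fun t => extDeriv v t ^ 2 * t ^ 2) volume (0 : ℝ) (n : ℝ) := by
  simpa using IntervalIntegrable.trans_iterate (a := fun k : ℕ => (k : ℝ)) (n := n)
    fun k _ => intervalIntegrable_extDeriv_sq v k

lemma memLp_extDeriv (hv : ∀ k ≥ N, v k = 0) : MemLp (extDeriv v) 2 (m 3) := by
  rw [memLp_m_iff (measurable_extDeriv v).aestronglyMeasurable,
    ← Ioc_union_Ioi_eq_Ioi (Nat.cast_nonneg (N + 1) : (0 : ℝ) ≤ ((N + 1 : ℕ) : ℝ))]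
  refine IntegrableOn.union ?_ ?_
  · have := intervalIntegrable_extDeriv_sq_zero v (N + 1)
    rwa [intervalIntegrable_iff_integrableOn_Ioc_of_le (Nat.cast_nonneg _)] at this
  · refine integrableOn_zero.congr_fun (fun t ht => ?_) measurableSet_Ioi
    simp [extDeriv_eq_zero hv (le_of_lt ht)]

lemma integral_Ioi_extDeriv_sq (hv : ∀ k ≥ N, v k = 0) :
    ∫ t in Ioi (0 : ℝ), extDeriv v t ^ 2 * t ^ 2 =
      ∑ k ∈ Finset.range N, ((k : ℝ) + 1) * ((k : ℝ) + 2) * (v (k + 1) - v k) ^ 2 := by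
  have h1 : ∫ t in Ioi (0 : ℝ), extDeriv v t ^ 2 * t ^ 2 =
      ∫ t in (0 : ℝ)..((N + 1 : ℕ) : ℝ), extDeriv v t ^ 2 * t ^ 2 := by
    rw [intervalIntegral.integral_of_le (Nat.cast_nonneg _)]
    refine setIntegral_eq_of_subset_of_forall_sdiff_eq_zero measurableSet_Ioi
      (fun t ht => ht.1) fun t ht => ?_
    have : ((N + 1 : ℕ) : ℝ) ≤ t := by
      by_contra hlt
      exact ht.2 ⟨ht.1, (not_le.1 hlt).le⟩
    simp [extDeriv_eq_zero hv this]
  have h2 := intervalIntegral.sum_integral_adjacent_intervals (a := fun k : ℕ => (k : ℝ))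
    (n := N + 1) fun k _ => intervalIntegrable_extDeriv_sq v k
  have h3 : ∫ t in ((0 : ℕ) : ℝ)..((0 + 1 : ℕ) : ℝ), extDeriv v t ^ 2 * t ^ 2 = 0 := by
    rw [← intervalIntegral.integral_congr_ae (extDeriv_sq_ae v 0)]
    simp [flux]
  rw [Finset.sum_range_succ', h3, add_zero] at h2
  simp only [integral_extDeriv_sq, Nat.cast_zero] at h2
  rw [h1, h2]

/-- The harmonic extension: `v k` at `k + 1`, constant on `(0, 1]`. -/
def ext (v : ℕ → ℝ) (x : ℝ) : ℝ := v 0 + ∫ t in (1 : ℝ)..x, extDeriv v t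

lemma ext_apply (hv : ∀ k ≥ N, v k = 0) (k : ℕ) : ext v ((k : ℝ) + 1) = v k := by
  have hL := memLp_extDeriv hv
  have h := intervalIntegral.sum_integral_adjacent_intervals
    (a := fun j : ℕ => ((j + 1 : ℕ) : ℝ)) (n := k) (f := extDeriv v) (μ := volume)
    fun j _ => intervalIntegrable_of_memLp hL (by positivity) (by positivity)
  simp only [integral_extDeriv, Finset.sum_range_sub v k] at h
  push_cast at h
  rw [ext, ← h]
  ring

lemma ext_eq_zero (hv : ∀ k ≥ N, v k = 0) {x : ℝ} (hx : (N : ℝ) + 1 ≤ x) : ext v x = 0 := by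
  have hL := memLp_extDeriv hv
  have hN : (0 : ℝ) < (N : ℝ) + 1 := by positivity
  have h1 := ext_apply hv N
  rw [hv N le_rfl, ext] at h1
  rw [ext, ← intervalIntegral.integral_add_adjacent_intervals
    (intervalIntegrable_of_memLp hL one_pos hN) (intervalIntegrable_of_memLp hL hN (hN.trans_le hx)),
    ← add_assoc, h1, zero_add]
  refine intervalIntegral.integral_zero_ae (ae_of_all _ fun t ht => ?_)
  rw [uIoc_of_le hx] at ht
  exact extDeriv_eq_zero hv (by push_cast; exact ht.1.le)

lemma abs_ext_le (hv : ∀ k ≥ N, v k = 0) : ∃ C, ∀ x, 0 < x → |ext v x| ≤ C := by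
  have hL := memLp_extDeriv hv
  refine ⟨|v 0| + √(1⁻¹ * (‖hL.toLp _‖ ^ 2 / 2)), fun x hx => (abs_add_le _ _).trans ?_⟩
  gcongr
  rcases le_total 1 x with h | h
  · exact abs_integral_le_norm hL one_pos h
  · have : ∫ t in (1 : ℝ)..x, extDeriv v t = 0 := by
      refine intervalIntegral.integral_zero_ae ?_
      filter_upwards [ae_floor_eq 0] with t ht htm
      rw [uIoc_comm, uIoc_of_le h] at htm
      rw [extDeriv, ht, flux, zero_mul]
      rw [uIoc_of_le (by simp)]
      simp only [CharP.cast_eq_zero, zero_add, Nat.cast_one]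
      exact ⟨hx.trans htm.1, htm.2⟩
    rw [this, abs_zero]
    positivity

/-- Square integrability holds because the extension is bounded on `(0, N+1]` and zero beyond. -/
lemma ext_mem_domain (hv : ∀ k ≥ N, v k = 0) : ext v ∈ domain 3 := by
  have hL := memLp_extDeriv hv
  have hAC : LocAC (ext v) := locAC_primitive hL (v 0)
  have hmeas : AEStronglyMeasurable (ext v) (m 3) :=
    (hAC.continuousOn.aestronglyMeasurable measurableSet_Ioi).mono_ac
      (withDensity_absolutelyContinuous _ _)
  refine mem_domain_iff.2 ⟨hAC, (memLp_congr_ae (deriv_primitive hL (v 0))).2 hL, ?_⟩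
  obtain ⟨C, hC⟩ := abs_ext_le hv
  have hN : (0 : ℝ) ≤ (N : ℝ) + 1 := by positivity
  rw [memLp_m_iff hmeas, ← Ioc_union_Ioi_eq_Ioi hN]
  refine IntegrableOn.union ?_ ?_
  · refine Integrable.mono' (integrableOn_const (C := C ^ 2 * ((N : ℝ) + 1) ^ 2) (by simp)) ?_ ?_
    · have h : ContinuousOn (fun x => ext v x ^ 2 * x ^ 2) (Ioi 0) :=
        (hAC.continuousOn.pow 2).mul (by fun_prop)
      exact (h.mono fun t ht => ht.1).aestronglyMeasurable measurableSet_Ioc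
    · refine (ae_restrict_iff' measurableSet_Ioc).2 (ae_of_all _ fun x hx => ?_)
      rw [Real.norm_of_nonneg (by positivity), ← sq_abs (ext v x)]
      have h1 := hC x hx.1
      have h2 := hx.1.le
      have h3 := hx.2
      gcongr
  · refine integrableOn_zero.congr_fun (fun t ht => ?_) measurableSet_Ioi
    simp [ext_eq_zero hv (le_of_lt ht)]

lemma form_ext_le (hv : ∀ k ≥ N, v k = 0) :
    ENNReal.ofReal (form 3 (ext v) (ext v)) ≤ energy v := by
  have h : form 3 (ext v) (ext v) = ∫ t in Ioi (0 : ℝ), extDeriv v t ^ 2 * t ^ 2 := by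
    rw [form_self]
    refine integral_congr_ae ((ae_restrict_iff' measurableSet_Ioi).2 ?_)
    filter_upwards [ae_m.1 (deriv_primitive (memLp_extDeriv hv) (v 0))] with t ht ht0
    have : deriv (ext v) t = extDeriv v t := ht ht0
    rw [this]
  rw [h, integral_Ioi_extDeriv_sq hv, ENNReal.ofReal_sum_of_nonneg fun k _ => by positivity]
  exact ENNReal.sum_le_tsum _

end finite

/-! ### Two-sided bounds for the trace forms -/

variable {a : ℕ+ → ℝ}

lemma seq_eq_of_graphJ {u : ℝ → ℝ} {f : ell2 a} (h : GraphJ 3 a u f) :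
    seq f = fun k : ℕ => u (k + 1) := by
  funext k
  rw [seq, h.2]
  simp

lemma Q_lt_top_of_mem_ranJ {f : ell2 a} (h : f ∈ ranJ 3 a) :
    Q a f < ⊤ ∧ Tendsto (seq f) atTop (𝓝 0) := by
  obtain ⟨u, hu⟩ := h
  rw [Q_eq_energy, seq_eq_of_graphJ hu]
  exact ⟨(energy_le_form ⟨u, hu.1.1⟩).trans_lt ENNReal.ofReal_lt_top,
    tendsto_zero_of_mem_domain ⟨u, hu.1.1⟩⟩

lemma Q_le_traceAt {lam : ℝ} (hlam : 0 < lam) (f : ell2 a) : Q a f ≤ traceAt 3 a lam f := by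
  refine le_sInf ?_
  rintro e ⟨u, w, hu, hw, rfl⟩
  -- `IsProj` does not say outright that `w` agrees with `u` on the integers, so `w` is exchanged
  -- for a projection known to do so, at equal form value.
  obtain ⟨w', hw', hp⟩ := exists_isProj hlam ⟨u, hu.1.1⟩
  have h := IsProj.formAt_eq hlam.le (u := ⟨u, hu.1.1⟩) (u' := ⟨u, hu.1.1⟩)
    (w := ⟨w, hw.mem_domain⟩) (w' := w') hw hp (by rw [sub_self]; exact zero_mem _)
  have hval : ∀ k : ℕ, u ((k : ℝ) + 1) = (w' : ℝ → ℝ) ((k : ℝ) + 1) := fun k => by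
    have := hw' k.succPNat
    simpa [sub_eq_zero] using this
  have h2 : form 3 w' w' ≤ formAt 3 lam w' w' := by
    rw [formAt]
    have : 0 ≤ ∫ x, (w' : ℝ → ℝ) x * (w' : ℝ → ℝ) x ∂(m 3) :=
      integral_nonneg fun x => mul_self_nonneg _
    have := mul_nonneg hlam.le this
    linarith
  rw [Q_eq_energy, seq_eq_of_graphJ hu, h]
  simp only [hval]
  exact (energy_le_form w').trans (ENNReal.ofReal_le_ofReal h2)

lemma mem_ranJ_of_traceAt_ne_top {lam : ℝ} {f : ell2 a} (h : traceAt 3 a lam f ≠ ⊤) :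
    f ∈ ranJ 3 a := by
  by_contra hf
  refine h (sInf_eq_top.2 ?_)
  rintro e ⟨u, w, hu, -, -⟩
  exact absurd ⟨u, hu⟩ hf

lemma graphJ_ext {f : ell2 a} {N : ℕ} (hf : ∀ k ≥ N, seq f k = 0) :
    GraphJ 3 a (ext (seq f)) f := by
  have hval : ∀ k : ℕ+, f k = ext (seq f) (k : ℝ) := by
    intro k
    have h := ext_apply hf k.natPred
    rw [seq, PNat.succPNat_natPred] at h
    rw [← h]
    congr 1
    exact_mod_cast PNat.natPred_add_one k
  refine ⟨⟨ext_mem_domain hf, ?_⟩, hval⟩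
  refine summable_of_ne_finset_zero (s := (Finset.range N).image Nat.succPNat) fun k hk => ?_
  have : f k = 0 := by
    have h := hf k.natPred (by
      by_contra hlt
      exact hk (Finset.mem_image.2 ⟨k.natPred, Finset.mem_range.2 (not_le.1 hlt),
        PNat.succPNat_natPred k⟩))
    rwa [seq, PNat.succPNat_natPred] at h
  rw [← hval, this]
  simp

lemma mem_ranJ_of_finite {f : ell2 a} {N : ℕ} (hf : ∀ k ≥ N, seq f k = 0) : f ∈ ranJ 3 a :=
  ⟨_, graphJ_ext hf⟩

/-- The harmonic extension is a competitor for every `lam` at once; `C` is its squared `L²(m)` norm.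
-/
lemma exists_traceAt_le {f : ell2 a} {N : ℕ} (hf : ∀ k ≥ N, seq f k = 0) :
    ∃ C : ℝ, 0 ≤ C ∧ ∀ lam : ℝ, 0 < lam →
      traceAt 3 a lam f ≤ Q a f + ENNReal.ofReal (lam * C) := by
  have hg := graphJ_ext hf
  refine ⟨∫ x, ext (seq f) x * ext (seq f) x ∂(m 3), integral_nonneg fun x => mul_self_nonneg _,
    fun lam hlam => ?_⟩
  obtain ⟨w, hw, hp⟩ := exists_isProj hlam ⟨_, hg.1.1⟩
  refine le_trans (b := ENNReal.ofReal (formAt 3 lam w w)) (sInf_le ⟨_, _, hg, hp, rfl⟩) ?_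
  refine (ENNReal.ofReal_le_ofReal (formAt_proj_le hlam.le hp.1 hw)).trans ?_
  rw [formAt, Q_eq_energy]
  exact ENNReal.ofReal_add_le.trans (add_le_add (form_ext_le hf) le_rfl)

end Bessel

/-! ### Weak lower semicontinuity and Mosco limits in a Hilbert space. -/

namespace QForm

variable {H : Type*} [NormedAddCommGroup H]

section inner

variable [InnerProductSpace ℝ H]

/-- A functional with closed convex sublevel sets is weakly sequentially lower semicontinuous. -/
lemma le_liminf_of_weak [CompleteSpace H] {F : H → ℝ≥0∞}
    (hconv : ∀ c : ℝ≥0∞, c < ⊤ → Convex ℝ {x | F x ≤ c})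
    (hclosed : ∀ c : ℝ≥0∞, c < ⊤ → IsClosed {x | F x ≤ c}) {s : ℕ → H} {u : H}
    (h : ∀ v : H, Tendsto (fun i => inner ℝ v (s i)) atTop (𝓝 (inner ℝ v u))) :
    F u ≤ liminf (fun i => F (s i)) atTop := by
  by_contra! hlt
  obtain ⟨c, hc1, hc2⟩ := exists_between hlt
  have hc : c < ⊤ := hc2.trans_le le_top
  -- A functional separates `u` from the sublevel set at `c`. Weak convergence puts `s i` eventually
  -- on the side of `u`, yet `s i` is frequently in that set.
  obtain ⟨g, r, hg1, hg2⟩ := geometric_hahn_banach_closed_point (hconv c hc) (hclosed c hc)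
    (x := u) (not_le.2 hc2)
  have hg := h ((InnerProductSpace.toDual ℝ H).symm g)
  simp only [InnerProductSpace.toDual_symm_apply] at hg
  obtain ⟨i, hi1, hi2⟩ :=
    ((frequently_lt_of_liminf_lt (by isBoundedDefault) hc1).and_eventually
      (hg.eventually_const_lt hg2)).exists
  exact (hg1 (s i) hi1.le).not_gt hi2

/-- A recovery sequence for `F` is tested in the lower bound for `E`; exchanging the roles gives
uniqueness of the limit. -/
lemma IsMoscoLimit.le {q : ℝ → H → ℝ≥0∞} {E F : H → ℝ≥0∞} (hE : IsMoscoLimit q E)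
    (hF : IsMoscoLimit q F) (u : H) : E u ≤ F u := by
  have hpos : ∀ i : ℕ, (0 : ℝ) < 1 / ((i : ℝ) + 1) := fun i => by positivity
  obtain ⟨s, hs, hle⟩ := (hF _ hpos tendsto_one_div_add_atTop_nhds_zero_nat).2 u
  refine ((hE _ hpos tendsto_one_div_add_atTop_nhds_zero_nat).1 s u fun v => ?_).trans
    ((liminf_le_limsup (by isBoundedDefault) (by isBoundedDefault)).trans hle)
  exact tendsto_const_nhds.inner hs

/-- A form below all `q lam`, weakly lower semicontinuous, and approximated by vectors on which
`q lam` exceeds it by a multiple of `lam`, is the Mosco limit. -/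
lemma isMoscoLimit_of_approx {q : ℝ → H → ℝ≥0∞} {E : H → ℝ≥0∞}
    (hle : ∀ lam : ℝ, 0 < lam → ∀ u, E u ≤ q lam u)
    (hlsc : ∀ (s : ℕ → H) (u : H),
      (∀ v : H, Tendsto (fun i => inner ℝ v (s i)) atTop (𝓝 (inner ℝ v u))) →
        E u ≤ liminf (fun i => E (s i)) atTop)
    (happ : ∀ u, E u < ⊤ → ∃ (f : ℕ → H) (C : ℕ → ℝ), Tendsto f atTop (𝓝 u) ∧ (∀ j, 0 ≤ C j) ∧
      ∀ j lam, 0 < lam → q lam (f j) ≤ E u + ENNReal.ofReal (lam * C j)) :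
    IsMoscoLimit q E := by
  intro lam hpos hlim
  refine ⟨fun s u h => (hlsc s u h).trans (liminf_le_liminf
    (Eventually.of_forall fun i => hle _ (hpos i) _)), fun u => ?_⟩
  by_cases hu : E u = ⊤
  · exact ⟨fun _ => u, tendsto_const_nhds, by rw [hu]; exact le_top⟩
  obtain ⟨f, C, hf, hC, hq⟩ := happ u (lt_top_iff_ne_top.2 hu)
  -- Diagonal choice: an index `j i` nearly minimising `d i` makes the distance to `u` and the
  -- excess `lam i * C (j i)` vanish together.
  let d : ℕ → ℕ → ℝ := fun i j => ‖f j - u‖ + lam i * C j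
  have hd : ∀ i j, 0 ≤ d i j := fun i j =>
    add_nonneg (norm_nonneg _) (mul_nonneg (hpos i).le (hC j))
  have hbdd : ∀ i, BddBelow (range (d i)) := fun i => ⟨0, by rintro _ ⟨j, rfl⟩; exact hd i j⟩
  have hex : ∀ i : ℕ, ∃ j, d i j < (⨅ j, d i j) + 1 / ((i : ℝ) + 1) := fun i =>
    exists_lt_of_ciInf_lt (lt_add_of_pos_right _ (by positivity))
  choose j hj using hex
  have hinf : Tendsto (fun i => ⨅ j, d i j) atTop (𝓝 0) := by
    refine tendsto_order.2 ⟨fun x hx => Eventually.of_forall fun i =>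
      hx.trans_le (le_ciInf (hd i)), fun x hx => ?_⟩
    have h1 : Tendsto (fun k => ‖f k - u‖) atTop (𝓝 0) := tendsto_iff_norm_sub_tendsto_zero.1 hf
    obtain ⟨k, hk⟩ := (h1.eventually_lt_const (half_pos hx)).exists
    have h2 : Tendsto (fun i => lam i * C k) atTop (𝓝 0) := by simpa using hlim.mul_const (C k)
    filter_upwards [h2.eventually_lt_const (half_pos hx)] with i hi
    refine (ciInf_le (hbdd i) k).trans_lt ?_
    simp only [d]
    linarith
  have hd0 : Tendsto (fun i => d i (j i)) atTop (𝓝 0) := by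
    refine squeeze_zero (fun i => hd i _) (fun i => (hj i).le) ?_
    simpa using hinf.add tendsto_one_div_add_atTop_nhds_zero_nat
  refine ⟨fun i => f (j i), ?_, ?_⟩
  · refine tendsto_iff_norm_sub_tendsto_zero.2
      (squeeze_zero (fun _ => norm_nonneg _) (fun i => ?_) hd0)
    exact le_add_of_nonneg_right (mul_nonneg (hpos i).le (hC _))
  · have h3 : Tendsto (fun i => E u + ENNReal.ofReal (d i (j i))) atTop (𝓝 (E u)) := by
      simpa using tendsto_const_nhds.add (ENNReal.tendsto_ofReal hd0)
    rw [← h3.limsup_eq]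
    refine limsup_le_limsup (Eventually.of_forall fun i => (hq (j i) _ (hpos i)).trans ?_)
    exact add_le_add le_rfl (ENNReal.ofReal_le_ofReal (le_add_of_nonneg_left (norm_nonneg _)))

end inner

end QForm

namespace Bessel

variable {a : ℕ+ → ℝ}

/-! ### Identification of the Mosco limit. -/

open Classical in
/-- The limit form: `Q` on the sequences vanishing at infinity. -/
def limitForm (a : ℕ+ → ℝ) (f : ell2 a) : ℝ≥0∞ :=
  if Tendsto (seq f) atTop (𝓝 0) then Q a f else ⊤

lemma limitForm_of_tendsto {f : ell2 a} (h : Tendsto (seq f) atTop (𝓝 0)) :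
    limitForm a f = Q a f := if_pos h

lemma Q_le_limitForm (f : ell2 a) : Q a f ≤ limitForm a f := by
  unfold limitForm
  split_ifs
  · exact le_rfl
  · exact le_top

lemma tendsto_of_limitForm_lt_top {f : ell2 a} (h : limitForm a f < ⊤) :
    Tendsto (seq f) atTop (𝓝 0) := by
  by_contra hn
  rw [limitForm, if_neg hn] at h
  exact lt_irrefl _ h

lemma limitForm_le_iff {f : ell2 a} {c : ℝ≥0∞} (hc : c < ⊤) :
    limitForm a f ≤ c ↔ energy (seq f) ≤ c ∧ Tendsto (seq f) atTop (𝓝 0) := by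
  rw [← Q_eq_energy]
  constructor
  · exact fun h => ⟨(Q_le_limitForm f).trans h, tendsto_of_limitForm_lt_top (h.trans_lt hc)⟩
  · rintro ⟨h1, h2⟩
    rwa [limitForm_of_tendsto h2]

lemma convex_limitForm_le (ha : ∀ k, 0 < a k) {c : ℝ≥0∞} (hc : c < ⊤) :
    Convex ℝ {f | limitForm a f ≤ c} := by
  intro f hf g hg s t hs ht hst
  rw [mem_ofPred_eq, limitForm_le_iff hc] at *
  rw [seq_add ha, seq_smul ha, seq_smul ha]
  refine ⟨(energy_convex hs ht hst _ _).trans ?_, ?_⟩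
  · calc _ ≤ ENNReal.ofReal s * c + ENNReal.ofReal t * c := by gcongr; exacts [hf.1, hg.1]
      _ = c := by rw [← add_mul, ← ENNReal.ofReal_add hs ht, hst, ENNReal.ofReal_one, one_mul]
  · simpa using (hf.2.const_mul s).add (hg.2.const_mul t)

/-- Norm convergence gives convergence of coordinates. Fatou bounds the energy of the limit, and the
uniform decay `c/(k+1)` passes to the limit, which therefore still vanishes at infinity. -/
lemma isClosed_limitForm_le (ha : ∀ k, 0 < a k) {c : ℝ≥0∞} (hc : c < ⊤) :
    IsClosed {f | limitForm a f ≤ c} := by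
  refine isSeqClosed_iff_isClosed.1 fun s f hs hf => ?_
  simp only [mem_ofPred_eq, limitForm_le_iff hc] at *
  have hpt : ∀ k, Tendsto (fun i => seq (s i) k) atTop (𝓝 (seq f k)) :=
    fun k => tendsto_apply ha hf _
  refine ⟨(energy_le_liminf hpt).trans
    (liminf_le_of_frequently_le' (Frequently.of_forall fun i => (hs i).1)), ?_⟩
  refine tendsto_zero_of_sq_le (c := c.toReal) fun k => ?_
  refine le_of_tendsto ((hpt k).pow 2) (Eventually.of_forall fun i => ?_)
  refine (sq_le_energy ((hs i).1.trans_lt hc) (hs i).2 k).trans ?_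
  have := ENNReal.toReal_mono hc.ne (hs i).1
  gcongr

lemma limitForm_le_traceAt {lam : ℝ} (hlam : 0 < lam) (f : ell2 a) :
    limitForm a f ≤ traceAt 3 a lam f := by
  by_cases h : traceAt 3 a lam f = ⊤
  · rw [h]
    exact le_top
  · rw [limitForm_of_tendsto (Q_lt_top_of_mem_ranJ (mem_ranJ_of_traceAt_ne_top h)).2]
    exact Q_le_traceAt hlam f

lemma isTraceForm_limitForm (ha : ∀ k, 0 < a k) : IsTraceForm 3 a (limitForm a) := by
  refine QForm.isMoscoLimit_of_approx (fun lam hlam f => limitForm_le_traceAt hlam f)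
    (fun s u h => QForm.le_liminf_of_weak (fun c hc => convex_limitForm_le ha hc)
      (fun c hc => isClosed_limitForm_le ha hc) h) fun u hu => ?_
  have hε : ∀ i : ℕ, (0 : ℝ) < 1 / ((i : ℝ) + 1) := fun i => by positivity
  have h0 := tendsto_of_limitForm_lt_top hu
  have hfin := fun i => eventually_residual_eq_zero ha h0 (hε i)
  choose N hN using hfin
  have hC := fun i => exists_traceAt_le (hN i)
  choose C hC0 hC using hC
  refine ⟨fun i => residual u (hε i).le, C,
    tendsto_residual ha u _ tendsto_one_div_add_atTop_nhds_zero_nat, hC0, fun j lam hlam => ?_⟩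
  refine (hC j lam hlam).trans ?_
  rw [limitForm_of_tendsto h0]
  gcongr
  exact Q_residual_le ha u _

/-! ### The closure of `Q` on the range of `J`. -/

lemma restrict_of_mem {f : ell2 a} (h : f ∈ ranJ 3 a) :
    QForm.restrict (Q a) (ranJ 3 a) f = Q a f := if_pos h

lemma Q_le_restrict (f : ell2 a) : Q a f ≤ QForm.restrict (Q a) (ranJ 3 a) f := by
  unfold QForm.restrict
  split_ifs
  · exact le_rfl
  · exact le_top

lemma mem_ranJ_of_restrict {f : ell2 a} (h : f ∈ QForm.dom (QForm.restrict (Q a) (ranJ 3 a))) :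
    f ∈ ranJ 3 a := by
  by_contra hn
  have h : QForm.restrict (Q a) (ranJ 3 a) f < ⊤ := h
  rw [QForm.restrict, if_neg hn] at h
  exact lt_irrefl _ h

/-- Along a sequence with `Q (s i - f) → 0` the values `Q (s i)` converge to `Q f`. -/
lemma tendsto_Q_of_sub (ha : ∀ k, 0 < a k) {s : ℕ → ell2 a} {f : ell2 a} (hf : Q a f < ⊤)
    (hs : Tendsto s atTop (𝓝 f)) (h : Tendsto (fun i => Q a (s i - f)) atTop (𝓝 0)) :
    Tendsto (fun i => Q a (s i)) atTop (𝓝 (Q a f)) := by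
  simp only [Q_eq_energy] at *
  refine tendsto_of_le_liminf_of_limsup_le (energy_le_liminf fun k => tendsto_apply ha hs _) ?_
  -- The term with factor `1 + t⁻¹` vanishes in the limit for fixed `t`; only afterwards does `t`
  -- tend to `0`.
  have hbound : ∀ t : ℝ, 0 < t →
      limsup (fun i => energy (seq (s i))) atTop ≤ ENNReal.ofReal (1 + t) * energy (seq f) := by
    intro t ht
    have hlim : Tendsto (fun i => ENNReal.ofReal (1 + t) * energy (seq f) +
        ENNReal.ofReal (1 + t⁻¹) * energy (seq (s i - f))) atTop
        (𝓝 (ENNReal.ofReal (1 + t) * energy (seq f))) := by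
      have := (ENNReal.Tendsto.const_mul h (Or.inr ENNReal.ofReal_ne_top) :
        Tendsto (fun i => ENNReal.ofReal (1 + t⁻¹) * energy (seq (s i - f))) atTop _)
      simpa using tendsto_const_nhds.add this
    rw [← hlim.limsup_eq]
    refine limsup_le_limsup (Eventually.of_forall fun i => ?_)
    refine le_trans (le_of_eq ?_) (energy_add_le ht (seq f) (seq (s i - f)))
    rw [← seq_add ha]
    simp
  have hlim : Tendsto (fun t : ℝ => ENNReal.ofReal (1 + t) * energy (seq f)) (𝓝[>] 0)
      (𝓝 (energy (seq f))) := by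
    have h1 : Tendsto (fun t : ℝ => ENNReal.ofReal (1 + t)) (𝓝[>] 0) (𝓝 1) := by
      have h2 : Tendsto (fun t : ℝ => 1 + t) (𝓝[>] 0) (𝓝 (1 + 0)) :=
        tendsto_const_nhds.add (tendsto_id.mono_left nhdsWithin_le_nhds)
      simpa using ENNReal.tendsto_ofReal h2
    simpa using ENNReal.Tendsto.mul_const h1 (Or.inr hf.ne)
  exact ge_of_tendsto hlim (eventually_nhdsWithin_of_forall fun t ht => hbound t ht)

lemma Q_sub_le (ha : ∀ k, 0 < a k) (f g : ell2 a) : Q a (f - g) ≤ 2 * Q a f + 2 * Q a g := by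
  simp only [Q_eq_energy, seq_sub ha]
  exact energy_sub_le _ _

/-- Fatou in the second index turns the Cauchy condition into `Q (s i - f) → 0`, so `Q (s i) → Q f`.
Applied to `f = 0` this is closability. -/
lemma approx_limit (ha : ∀ k, 0 < a k) {s : ℕ → ell2 a} {f : ell2 a}
    (h : QForm.Approx (QForm.restrict (Q a) (ranJ 3 a)) s f) :
    limitForm a f < ⊤ ∧
      Tendsto (fun i => QForm.restrict (Q a) (ranJ 3 a) (s i)) atTop (𝓝 (limitForm a f)) := by
  obtain ⟨hdom, hs, hcauchy⟩ := h
  have hran := fun i => mem_ranJ_of_restrict (hdom i)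
  have hQ := fun i => Q_lt_top_of_mem_ranJ (hran i)
  have hsub : Tendsto (fun i => Q a (s i - f)) atTop (𝓝 0) := by
    refine ENNReal.tendsto_nhds_zero.2 fun ε hε => ?_
    obtain ⟨N, hN⟩ := hcauchy ε hε
    refine eventually_atTop.2 ⟨N, fun i hi => ?_⟩
    rw [Q_eq_energy]
    refine (energy_le_liminf (v := fun j => seq (s i - s j))
      fun k => tendsto_apply ha (hs.const_sub (s i)) _).trans ?_
    refine liminf_le_of_frequently_le' (Eventually.frequently
      (eventually_atTop.2 ⟨N, fun j hj => ?_⟩))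
    rw [← Q_eq_energy]
    exact (Q_le_restrict _).trans (hN i hi j hj).le
  obtain ⟨i, hi⟩ := (hsub.eventually_lt_const one_pos).exists
  have hQf : Q a f < ⊤ := by
    have h1 := Q_sub_le ha (s i) (s i - f)
    rw [sub_sub_cancel] at h1
    refine h1.trans_lt (ENNReal.add_lt_top.2 ⟨?_, ?_⟩)
    · exact ENNReal.mul_lt_top (by simp) (hQ i).1
    · exact ENNReal.mul_lt_top (by simp) (hi.trans ENNReal.one_lt_top)
  have hlimQ := tendsto_Q_of_sub ha hQf hs hsub
  -- Vanishing of `f` at infinity is not yet known. It follows because the `s i` eventually lie in a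
  -- closed sublevel set of `limitForm`.
  have hf : limitForm a f ≤ Q a f + 1 := by
    refine (isClosed_limitForm_le ha (ENNReal.add_lt_top.2 ⟨hQf, ENNReal.one_lt_top⟩)).mem_of_tendsto
      hs ?_
    have : Q a f < Q a f + 1 := ENNReal.lt_add_right hQf.ne one_ne_zero
    filter_upwards [hlimQ.eventually_lt_const this] with j hj
    rw [limitForm_of_tendsto (hQ j).2]
    exact hj.le
  have hlt : limitForm a f < ⊤ :=
    hf.trans_lt (ENNReal.add_lt_top.2 ⟨hQf, ENNReal.one_lt_top⟩)
  refine ⟨hlt, ?_⟩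
  rw [limitForm_of_tendsto (tendsto_of_limitForm_lt_top hlt)]
  exact hlimQ.congr fun i => (restrict_of_mem (hran i)).symm

lemma exists_approx (ha : ∀ k, 0 < a k) {f : ell2 a} (hf : limitForm a f < ⊤) :
    ∃ s, QForm.Approx (QForm.restrict (Q a) (ranJ 3 a)) s f := by
  have hε : ∀ i : ℕ, (0 : ℝ) < 1 / ((i : ℝ) + 1) := fun i => by positivity
  have h0 := tendsto_of_limitForm_lt_top hf
  have hQf : Q a f < ⊤ := (Q_le_limitForm f).trans_lt hf
  have hfin := fun i => eventually_residual_eq_zero ha h0 (hε i)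
  choose N hN using hfin
  have hran := fun i => mem_ranJ_of_finite (hN i)
  have hsub := tendsto_Q_residual_sub ha hQf (fun i => (hε i).le)
    tendsto_one_div_add_atTop_nhds_zero_nat
  refine ⟨fun i => residual f (hε i).le, fun i => ?_,
    tendsto_residual ha f _ tendsto_one_div_add_atTop_nhds_zero_nat, fun ε hε0 => ?_⟩
  · show QForm.restrict (Q a) (ranJ 3 a) _ < ⊤
    rw [restrict_of_mem (hran i)]
    exact (Q_lt_top_of_mem_ranJ (hran i)).1
  · obtain ⟨M, hM⟩ := eventually_atTop.1
      (hsub.eventually_lt_const (ENNReal.div_pos hε0.ne' (by norm_num : (4 : ℝ≥0∞) ≠ ⊤)))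
    refine ⟨M, fun i hi j hj => ?_⟩
    -- The restricted form is infinite off `ranJ`, so the difference must be placed there; finite
    -- support suffices.
    have hmem : residual f (hε i).le - residual f (hε j).le ∈ ranJ 3 a := by
      refine mem_ranJ_of_finite (N := max (N i) (N j)) fun k hk => ?_
      simp only [seq_sub ha]
      rw [hN i k ((le_max_left _ _).trans hk), hN j k ((le_max_right _ _).trans hk), sub_zero]
    rw [restrict_of_mem hmem]
    have h1 := Q_sub_le ha (residual f (hε i).le - f) (residual f (hε j).le - f)
    rw [sub_sub_sub_cancel_right] at h1
    refine h1.trans_lt ?_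
    calc _ < 2 * (ε / 4) + 2 * (ε / 4) := by
          refine ENNReal.add_lt_add ?_ ?_
          · exact (ENNReal.mul_lt_mul_iff_right (by simp) (by simp)).2 (hM i hi)
          · exact (ENNReal.mul_lt_mul_iff_right (by simp) (by simp)).2 (hM j hj)
      _ = ε := by
          rw [← add_mul, show (2 + 2 : ℝ≥0∞) = 4 by norm_num, ENNReal.mul_div_cancel' (by norm_num) (by norm_num)]

lemma isClosureOf_limitForm (ha : ∀ k, 0 < a k) :
    QForm.IsClosureOf (limitForm a) (QForm.restrict (Q a) (ranJ 3 a)) := by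
  refine ⟨fun s hs => ?_, fun u => ⟨exists_approx ha, ?_⟩, fun u s hs => (approx_limit ha hs).2⟩
  · have h := (approx_limit ha hs).2
    rwa [limitForm_of_tendsto (by rw [seq_zero ha]; exact tendsto_const_nhds), Q_zero ha] at h
  · rintro ⟨s, hs⟩
    exact (approx_limit ha hs).1

end Bessel

end

theorem mainTheorem2 (a : ℕ+ → ℝ) (ha : ∀ k, 0 < a k) :
    ∃ E : Bessel.ell2 a → ℝ≥0∞,
      (∀ F : Bessel.ell2 a → ℝ≥0∞, Bessel.IsTraceForm 3 a F ↔ F = E) ∧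
      QForm.IsClosureOf E (QForm.restrict (Bessel.Q a) (Bessel.ranJ 3 a)) ∧
      (Bessel.atomic a Set.univ = ⊤ →
        QForm.dom E = {u | Bessel.Q a u < ⊤} ∧ ∀ u ∈ QForm.dom E, E u = Bessel.Q a u) := by
  have hE := Bessel.isTraceForm_limitForm ha
  refine ⟨Bessel.limitForm a, fun F => ⟨fun hF => ?_, ?_⟩, Bessel.isClosureOf_limitForm ha,
    fun hinf => ⟨?_, fun u hu => ?_⟩⟩
  · exact funext fun u => le_antisymm (QForm.IsMoscoLimit.le hF hE u)
      (QForm.IsMoscoLimit.le hE hF u)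
  · rintro rfl
    exact hE
  · ext u
    refine ⟨fun hu => (Bessel.Q_le_limitForm u).trans_lt hu, fun hu => ?_⟩
    show Bessel.limitForm a u < ⊤
    rwa [Bessel.limitForm_of_tendsto (Bessel.tendsto_seq_of_infinite hinf hu)]
  · exact Bessel.limitForm_of_tendsto (Bessel.tendsto_of_limitForm_lt_top hu)
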